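/- **Conventions.** A tiling is an edge-to-edge tiling of the sphere by pentagons, regarded combinatorially: a connected cell decomposition of the oriented sphere in which every face (tile) is a pentagon with five distinct vertices, together with a label on each corner of each tile, such that all tiles are congruent, i.e. the cyclic sequence of the five corner labels is the same for all tiles up to rotation and reversal. The labels are symbols, not angle values. Tilings are considered up to isomorphism and mirror image. A tiling is a tiling for $\{f\,\alpha^3\beta\gamma\colon n_1V_1, n_2V_2,\dots\}$ if it has $f$ tiles, each tile has corner labels $\alpha,\alpha,\alpha,\beta,\gamma$ (in some cyclic order), and there are exactly $n_i$ vertices at which the corner labels are $V_i$, for each $i$, and no other vertices. We consider $$\text{AVC(3B24)}=\{24\alpha^3\beta\gamma\colon 24\alpha^2\beta,\ 8\alpha^3,\ 6\gamma^4\},\qquad \text{AVC(3B60)}=\{60\alpha^3\beta\gamma\colon 60\alpha^2\beta,\ 20\alpha^3,\ 12\gamma^5\}.$$ Let $P$ be the cube $P_6$ or the dodecahedron $P_{12}$. The pentagonal subdivision $PP$ of $P$ (that is, $PP_6$ or $PP_{12}$) is obtained by inserting two points into each edge of $P$ and a centre into each face, and joining the centre of each face to one inserted point of each of its sides, namely the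 second one met when going counterclockwise around the face. It has one tile for each corner of a face of $P$. Label the corners of this tile, counterclockwise from the centre of the face, by $\epsilon,\alpha,\delta,\beta,\gamma$; so $\epsilon$ is at the centre of the face, $\delta$ is at the vertex of $P$, and $\alpha,\beta,\gamma$ are at inserted points. The reductions $3\mathrm B_1$, $3\mathrm B_2$, $3\mathrm B_3$ of $PP$ are obtained by replacing the labels $\alpha,\beta,\gamma,\delta,\epsilon$ by, respectively, $$\beta,\alpha,\alpha,\alpha,\gamma;\qquad \alpha,\beta,\alpha,\alpha,\gamma;\qquad \alpha,\alpha,\beta,\alpha,\gamma.$$ In a reduction, $N(\gamma^4)$ (for $P_6$) or $N(\gamma^5)$ (for $P_{12}$) denotes the union of the tiles around the centre of a face of $P$. In $3\mathrm B_1$ and $3\mathrm B_3$, the two neighbours of $\gamma$ in each tile are labelled $\alpha$ and $\beta$; the orientation of $N(\gamma^4)$ or $N(\gamma^5)$ is reversed by exchanging these two labels in all of its tiles. In $3\mathrm B_2$, each tile has $\alpha$ at its vertex $\bullet$ of $P$ and $\beta$ at the adjacent inserted point (the corner labelled $\beta$ in $PP$). To configure a vertex $\bullet$ of $P$ means to choose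 at most one of the three tiles at $\bullet$ and to exchange these two labels $\alpha,\beta$ in the chosen tile; so the labels at $\bullet$ are $\alpha^3$ if no tile is chosen and $\alpha^2\beta$ otherwise. **Theorem 5.** The $3\mathrm B_1$, $3\mathrm B_2$, $3\mathrm B_3$ reductions of $PP_6$, respectively $PP_{12}$, are tilings for AVC(3B24), respectively AVC(3B60). All the tilings for AVC(3B24), respectively AVC(3B60), are these reductions of $PP_6$, respectively $PP_{12}$, and the following modifications. 1. The tilings in which $\beta,\gamma$ are adjacent in the pentagon are exactly those obtained from the $3\mathrm B_1$ reduction (equivalently, from the $3\mathrm B_3$ reduction) by choosing the orientation of each $N(\gamma^4)$, respectively $N(\gamma^5)$, independently: every choice gives a tiling for the AVC, and every such tiling arises from some choice. 2. The tilings in which $\beta,\gamma$ are not adjacent in the pentagon are exactly those obtained from the $3\mathrm B_2$ reduction by configuring each vertex $\bullet$ of $P$ independently (four possibilities at each $\bullet$): every choice gives a tiling for the AVC, and every such tiling arises from some choice. -/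

import Mathlib

open Equiv

namespace PentTiling

/-! ## Cell decompositions of oriented closed surfaces, as combinatorial maps -/

/-- A cell decomposition of an oriented closed surface, given by its set `D` of darts (directed
edges). `opp d` is the dart `d` with its direction reversed; `next d` is the dart following `d` on
the boundary of the face on the left of `d`, traversed counterclockwise.
A dart `d` also stands for a corner: the corner at the starting point of `d` of the face on the left
of `d`. -/
structure OrientedMap (D : Type*) where
  next : Perm D
  opp : Perm D
  opp_opp : ∀ d, opp (opp d) = d
  opp_ne : ∀ d, opp d ≠ d

namespace OrientedMap

variable {D : Type*} (M : OrientedMap D)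

/-- The counterclockwise rotation around the starting point of a dart. -/
def rot : Perm D := M.next.symm.trans M.opp

/-- The vertices are the cycles of `rot`. -/
def Vertex : Type _ := Quotient (Perm.SameCycle.setoid M.rot)

/-- The (undirected) edges are the cycles of `opp`. -/
def Edge : Type _ := Quotient (Perm.SameCycle.setoid M.opp)

/-- The faces are the cycles of `next`. -/
def Face : Type _ := Quotient (Perm.SameCycle.setoid M.next)

/-- The starting point of a dart, which is the vertex of the corner `d`. -/
def vertex (d : D) : M.Vertex := Quotient.mk (Perm.SameCycle.setoid M.rot) d

/-- The face on the left of a dart, which is the face of the corner `d`. -/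
def face (d : D) : M.Face := Quotient.mk (Perm.SameCycle.setoid M.next) d

/-- The surface is connected. -/
def Connected : Prop :=
  ∀ x y : D, Relation.EqvGen (fun a b => b = M.next a ∨ b = M.opp a) x y

/-- The surface is the sphere: it is connected and has Euler characteristic `2`. -/
def IsSphere : Prop :=
  M.Connected ∧ (Nat.card M.Vertex : ℤ) - Nat.card M.Edge + Nat.card M.Face = 2

/-- Every face is a pentagon, with five distinct vertices. -/
def Pentagonal : Prop :=
  ∀ d : D, (M.next ^ 5) d = d ∧
    Function.Injective (fun i : Fin 5 => M.vertex ((M.next ^ (i : ℕ)) d))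

end OrientedMap

/-! ## Tilings with labelled corners -/

/-- A map with a label on each corner. -/
structure LabelledMap (D L : Type*) extends OrientedMap D where
  label : D → L

/-- The data `{f T : n₁ V₁, n₂ V₂, …}` of an anglewise vertex combination: the number `f` of tiles,
the labels of the corners of a tile, and the list of the label combinations at all vertices,
with multiplicities. -/
structure AVC (L : Type*) where
  numTiles : ℕ
  tile : Multiset L
  vertices : Multiset (Multiset L)

namespace LabelledMap

variable {D D₁ D₂ L : Type*}

open Classical in
/-- The labels of the corners at a vertex. -/
noncomputable def cornersAt [Fintype D] (T : LabelledMap D L) (v : T.Vertex) : Multiset L :=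
  (Finset.univ.filter (fun d : D => T.vertex d = v)).val.map T.label

open Classical in
/-- The label combinations at all the vertices, with multiplicities. -/
noncomputable def vertexCombinations [Fintype D] (T : LabelledMap D L) : Multiset (Multiset L) :=
  letI : Fintype T.Vertex :=
    inferInstanceAs (Fintype (Quotient (Perm.SameCycle.setoid T.rot)))
  (Finset.univ : Finset T.Vertex).val.map T.cornersAt

/-- All tiles are congruent to the pentagon with corner labels `w 0, …, w 4` in cyclic order:
the labels of each tile, read counterclockwise from any corner,
are the cyclic sequence `w`, read forward or backward. -/
def CongruentTo (T : LabelledMap D L) (w : Fin 5 → L) : Prop :=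
  ∀ d : D, ∃ k : Fin 5,
    (∀ i : Fin 5, T.label ((T.next ^ (i : ℕ)) d) = w (k + i)) ∨
    (∀ i : Fin 5, T.label ((T.next ^ (i : ℕ)) d) = w (k - i))

/-- `T` is a tiling of the sphere by congruent pentagons, with anglewise vertex combination `A`. -/
def IsTilingFor [Fintype D] (T : LabelledMap D L) (A : AVC L) : Prop :=
  T.IsSphere ∧ T.Pentagonal ∧
  (∃ w : Fin 5 → L, (Finset.univ : Finset (Fin 5)).val.map w = A.tile ∧ T.CongruentTo w) ∧
  Nat.card T.Face = A.numTiles ∧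
  T.vertexCombinations = A.vertices

/-- The labels `a` and `b` are at adjacent corners of a tile. -/
def AdjacentInTile (T : LabelledMap D L) (a b : L) : Prop :=
  ∃ d : D, (T.label d = a ∧ T.label (T.next d) = b) ∨ (T.label d = b ∧ T.label (T.next d) = a)

/-- The mirror image. The corners are unchanged, and the surface has the opposite orientation. -/
def mirror (T : LabelledMap D L) : LabelledMap D L where
  next := T.next.symm
  opp := (T.next.symm.trans T.opp).trans T.next
  opp_opp d := by simp [T.opp_opp]
  opp_ne d h := T.opp_ne (T.next.symm d) (by
    apply T.next.injective
    simpa using h)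
  label := T.label

/-- Orientation preserving isomorphism of labelled maps. -/
def DirectIso (T₁ : LabelledMap D₁ L) (T₂ : LabelledMap D₂ L) : Prop :=
  ∃ f : D₁ ≃ D₂, (∀ d, f (T₁.next d) = T₂.next (f d)) ∧ (∀ d, f (T₁.opp d) = T₂.opp (f d)) ∧
    ∀ d, T₂.label (f d) = T₁.label d

/-- The two labelled maps are the same, up to isomorphism and mirror image. -/
def Same (T₁ : LabelledMap D₁ L) (T₂ : LabelledMap D₂ L) : Prop :=
  DirectIso T₁ T₂ ∨ DirectIso T₁ T₂.mirror

end LabelledMap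

/-! ## The cube and the dodecahedron -/

/-- The faces of the cube. The side faces are numbered eastward. -/
inductive CubeFace
  | top
  | side (i : Fin 4)
  | bottom
  deriving DecidableEq, Fintype

/-- The darts of the cube are the pairs `(F, j)`, for the `j`-th side of the face `F`. The sides of
each face are numbered counterclockwise, seen from outside. The sides `0, 1, 2, 3` of a side face
are its top, west, bottom and east sides. -/
def cubeOpp : CubeFace × Fin 4 → CubeFace × Fin 4
  | (.top, i) => (.side i, 0)
  | (.side i, 0) => (.top, i)
  | (.side i, 1) => (.side (i - 1), 3)
  | (.side i, 2) => (.bottom, -i)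
  | (.side i, 3) => (.side (i + 1), 1)
  | (.bottom, j) => (.side (-j), 2)

theorem cubeOpp_involutive : Function.Involutive cubeOpp := by
  unfold Function.Involutive; decide

/-- The cube. -/
def cube : OrientedMap (CubeFace × Fin 4) where
  next := (Equiv.refl CubeFace).prodCongr (Equiv.addRight (1 : Fin 4))
  opp := cubeOpp_involutive.toPerm
  opp_opp := cubeOpp_involutive
  opp_ne := by
    change ∀ d, cubeOpp d ≠ d
    decide

/-- The faces of the dodecahedron: the top face, the five faces adjacent to it, the five faces
adjacent to the bottom face, and the bottom face. The two rings of faces are numbered eastward,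
such that `lower i` is adjacent to `upper i` and `upper (i + 1)`. -/
inductive DodecahedronFace
  | top
  | upper (i : Fin 5)
  | lower (i : Fin 5)
  | bottom
  deriving DecidableEq, Fintype

/-- The darts of the dodecahedron are the pairs `(F, j)`, for the `j`-th side of the face `F`. The
sides of each face are numbered counterclockwise, seen from outside. The sides `0, 1, 2, 3, 4` of an
upper face are its top, west, southwest, southeast and east sides, and those of a lower face
are its bottom, east, northeast, northwest and west sides. -/
def dodecahedronOpp : DodecahedronFace × Fin 5 → DodecahedronFace × Fin 5
  | (.top, i) => (.upper i, 0)
  | (.upper i, 0) => (.top, i)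
  | (.upper i, 1) => (.upper (i - 1), 4)
  | (.upper i, 2) => (.lower (i - 1), 2)
  | (.upper i, 3) => (.lower i, 3)
  | (.upper i, 4) => (.upper (i + 1), 1)
  | (.lower i, 0) => (.bottom, -i)
  | (.lower i, 1) => (.lower (i + 1), 4)
  | (.lower i, 2) => (.upper (i + 1), 2)
  | (.lower i, 3) => (.upper i, 3)
  | (.lower i, 4) => (.lower (i - 1), 1)
  | (.bottom, j) => (.lower (-j), 0)

theorem dodecahedronOpp_involutive : Function.Involutive dodecahedronOpp := by
  unfold Function.Involutive; decide

/-- The dodecahedron. -/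
def dodecahedron : OrientedMap (DodecahedronFace × Fin 5) where
  next := (Equiv.refl DodecahedronFace).prodCongr (Equiv.addRight (1 : Fin 5))
  opp := dodecahedronOpp_involutive.toPerm
  opp_opp := dodecahedronOpp_involutive
  opp_ne := by
    change ∀ d, dodecahedronOpp d ≠ d
    decide

/-! ## Pentagonal subdivision -/

section Subdivision

variable {D : Type*} (P : OrientedMap D)

/-- How the tiles of the pentagonal subdivision are glued, see `pentSub`. -/
def pentSubOpp : D × Fin 5 → D × Fin 5
  | (d, 0) => (P.next.symm d, 4)
  | (d, 1) => (P.rot d, 2)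
  | (d, 2) => (P.rot.symm d, 1)
  | (d, 3) => (P.opp d, 3)
  | (d, 4) => (P.next d, 0)

theorem pentSubOpp_involutive : Function.Involutive (pentSubOpp P) := by
  rintro ⟨d, i⟩
  fin_cases i <;> simp [pentSubOpp, P.opp_opp]

/-- The pentagonal subdivision of `P`. Two points are inserted into each edge of `P`, and each face of
`P` gets a centre. The centre of a face is joined to one inserted point of each side of the face: going
counterclockwise around the face, the second of the two inserted points of the side. Therefore
the first inserted point is joined to the centre of the face on the other side.
This divides the face into pentagons, one for each corner `d` of the face. Let `v` be the vertex of
the corner `d`. The corners of the pentagon are, counterclockwise,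
* `(d, 0)`, at the centre of the face;
* `(d, 1)`, at the inserted point, joined to this centre, of the side before `v`;
* `(d, 2)`, at `v`;
* `(d, 3)`, at the inserted point, joined to the centre of the other face, of the side `d` after `v`;
* `(d, 4)`, at the inserted point, joined to this centre, of the side `d` after `v`. -/
def pentSub : OrientedMap (D × Fin 5) where
  next := (Equiv.refl D).prodCongr (Equiv.addRight (1 : Fin 5))
  opp := (pentSubOpp_involutive P).toPerm
  opp_opp := pentSubOpp_involutive P
  opp_ne := by
    rintro ⟨d, i⟩
    fin_cases i <;> simp [pentSubOpp, P.opp_ne]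

end Subdivision

/-! ## Labels and reductions -/

/-- The five distinct labels. -/
inductive Label5
  | α
  | β
  | γ
  | δ
  | ε
  deriving DecidableEq

/-- The three distinct labels. -/
inductive Label3
  | α
  | β
  | γ
  deriving DecidableEq

/-- The five labels of a tile in the pentagonal subdivision: `ε` at the centres of the faces of `P`,
`δ` at the vertices of `P`, and `α, β, γ` at the inserted points. -/
def label5 : Fin 5 → Label5 := ![.ε, .α, .δ, .β, .γ]

/-- The reduction `β = γ = δ`, i.e., `α, β, γ, δ, ε → β, α, α, α, γ`. -/
def red3B1 : Label5 → Label3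
  | .α => .β
  | .β => .α
  | .γ => .α
  | .δ => .α
  | .ε => .γ

/-- The reduction `α = γ = δ`, i.e., `α, β, γ, δ, ε → α, β, α, α, γ`. -/
def red3B2 : Label5 → Label3
  | .α => .α
  | .β => .β
  | .γ => .α
  | .δ => .α
  | .ε => .γ

/-- The reduction `α = β = δ`, i.e., `α, β, γ, δ, ε → α, α, β, α, γ`. -/
def red3B3 : Label5 → Label3
  | .α => .α
  | .β => .α
  | .γ => .β
  | .δ => .α
  | .ε => .γ

section Modifications

variable {D : Type*} (P : OrientedMap D)

/-- The reduction `r` of the pentagonal subdivision of `P`. -/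
def reduction (r : Label5 → Label3) : LabelledMap (D × Fin 5) Label3 where
  toOrientedMap := pentSub P
  label c := r (label5 c.2)

open Classical in
/-- Reversal of the orientation of some of the neighbourhoods `N(γ⁴)` or `N(γ⁵)` in the reduction `r`
of the pentagonal subdivision of `P`. Each such neighbourhood consists of the tiles around the centre
of one face of `P`, and `S` is the set of the faces for which it is reversed. The reversal flips
the labels of each of its tiles, with respect to the axis through the corner `γ` at the centre. -/
noncomputable def reorient (r : Label5 → Label3) (S : Set P.Face) :
    LabelledMap (D × Fin 5) Label3 where
  toOrientedMap := pentSub P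
  label c := if P.face c.1 ∈ S then r (label5 (-c.2)) else r (label5 c.2)

/-- The configurations of labels around a vertex `v` of `P`: either all the corners at `v` have the
label `α` (`none`), or exactly one corner `d` at `v` has the label `β` (`some d`). -/
abbrev Configuration (v : P.Vertex) : Type _ := Option {d : D // P.vertex d = v}

open Classical in
/-- The labels of the reduction `r` of the pentagonal subdivision of `P`, with each vertex `v` of `P`
configured according to `c v`: in the tile `d` chosen by `c v` (if any), the label at `v`, which is
the corner `2` of the tile, is exchanged with the label at the neighbouring inserted point, which
is the corner `3` of the tile. -/
noncomputable def configure (r : Label5 → Label3) (c : ∀ v : P.Vertex, Configuration P v) :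
    LabelledMap (D × Fin 5) Label3 where
  toOrientedMap := pentSub P
  label x :=
    if c (P.vertex x.1) = some ⟨x.1, rfl⟩ then r (label5 (Equiv.swap 2 3 x.2)) else r (label5 x.2)

end Modifications

/-! ## The two anglewise vertex combinations -/

open Label3 in
/-- `{24 α³βγ : 24 α²β, 8 α³, 6 γ⁴}` -/
def avc3B24 : AVC Label3 where
  numTiles := 24
  tile := {α, α, α, β, γ}
  vertices := Multiset.replicate 24 {α, α, β} + Multiset.replicate 8 {α, α, α} +
    Multiset.replicate 6 {γ, γ, γ, γ}

open Label3 in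
/-- `{60 α³βγ : 60 α²β, 20 α³, 12 γ⁵}` -/
def avc3B60 : AVC Label3 where
  numTiles := 60
  tile := {α, α, α, β, γ}
  vertices := Multiset.replicate 60 {α, α, β} + Multiset.replicate 20 {α, α, α} +
    Multiset.replicate 12 {γ, γ, γ, γ, γ}

end PentTiling

namespace PentTiling

/-! ## Cycles of permutations -/

section Cycles

/-! Everything global follows from the tiles and the vertices. If every vertex is α²β, α³ or γⁿ,
then counting labels over tiles and over vertices forces the multiplicities, and these give Euler
characteristic 2. So a tiling for the AVC is the same as an `IsLocalTiling`
(`isTilingFor_avcOf_iff`).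

Now forget α and β. Each tile has one corner γ, from which its corners get positions 0 to 4; γ meets
only γ, and every other vertex has degree 3 (`exists_isCentred`). This almost fixes the gluing. The
edges at the centre join position 0 to position 4, and the edge from position 1 to 2 is glued either
to an edge from 2 to 3 or to an edge from 1 to 2. Degree 3 carries the first choice over to every
adjacent tile, so by connectedness one choice holds everywhere (`pos_opp_one_dichotomy`). The first
choice makes the map a pentagonal subdivision, of the map whose darts are the γ corners
(`exists_pentSub`); the second makes its mirror image one.

The subdivided map is connected, with `next ^ n = 1`, `rot ^ 3 = 1` and the right number of darts.
For n = 4, 5 this leaves only the cube and the dodecahedron (`isDetermined_of_words`): suitable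
words in the two permutations, applied to one dart, give an equivariant surjection from the darts of
the standard solid, bijective by cardinality.

It remains to place β. In each tile it is at position c or -c for a fixed c, and complementing the
set of flipped tiles exchanges c with -c, so c = 1 or c = 3. The only constraint is that no vertex
has two corners β. For c = 1 it says that flipping is constant around each face of P; for c = 3 it
says that at most one tile is flipped at each vertex of P. These are the reorientations and the
configurations. -/

open Classical in
theorem filter_sameCycle_val {D : Type*} [Fintype D] (f : Perm D) (x : D) :
    (Finset.univ.filter (fun y => f.SameCycle x y)).val =
      (Multiset.range (Function.minimalPeriod f x)).map (fun i => (f ^ i) x) := by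
  have hpos : 0 < Function.minimalPeriod f x :=
    Function.minimalPeriod_pos_of_mem_periodicPts (f.injective.mem_periodicPts x)
  refine (Multiset.Nodup.ext (Finset.nodup _) ?_).2 ?_
  · refine Multiset.Nodup.map_on ?_ (Multiset.nodup_range _)
    intro i hi j hj hij
    simp only [← Perm.iterate_eq_pow] at hij
    exact (Function.iterate_injOn_Iio_minimalPeriod (f := f) (x := x))
      (Multiset.mem_range.1 hi) (Multiset.mem_range.1 hj) hij
  · intro y
    simp only [Finset.mem_val, Finset.mem_filter, Finset.mem_univ, true_and, Multiset.mem_map,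
      Multiset.mem_range]
    constructor
    · intro h
      obtain ⟨i, hi⟩ := h.exists_nat_pow_eq
      refine ⟨i % Function.minimalPeriod f x, Nat.mod_lt _ hpos, ?_⟩
      rw [← hi, ← Perm.iterate_eq_pow, ← Perm.iterate_eq_pow,
        Function.iterate_mod_minimalPeriod_eq]
    · rintro ⟨i, -, rfl⟩
      exact ⟨i, by simp⟩

open Classical in
theorem card_filter_sameCycle {D : Type*} [Fintype D] (f : Perm D) (x : D) :
    (Finset.univ.filter (fun y => f.SameCycle x y)).card = Function.minimalPeriod f x := by
  rw [Finset.card_def, filter_sameCycle_val]; simp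

theorem card_eq_mul_card_cycles {D : Type*} [Fintype D] (f : Perm D) (c : ℕ)
    (h : ∀ x, Function.minimalPeriod f x = c) :
    Nat.card D = c * Nat.card (Quotient (Perm.SameCycle.setoid f)) := by
  classical
  rw [Nat.card_eq_fintype_card, Nat.card_eq_fintype_card, ← Finset.card_univ (α := D),
    Finset.card_eq_sum_card_fiberwise (f := fun x => Quotient.mk (Perm.SameCycle.setoid f) x)
      (t := Finset.univ) (by simp [Set.MapsTo])]
  rw [Finset.sum_const_nat (m := c), Finset.card_univ, mul_comm]
  intro q _
  induction q using Quotient.inductionOn with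
  | h x =>
    rw [← h x, ← card_filter_sameCycle]
    congr 1
    ext y
    simp only [Finset.mem_filter, Finset.mem_univ, true_and]
    exact ⟨fun hh => (Quotient.exact hh).symm, fun hh => Quotient.sound hh.symm⟩

theorem minimalPeriod_eq_of_prime {D : Type*} (f : Perm D) {p : ℕ} (hp : p.Prime) {x : D}
    (h : (f ^ p) x = x) (h1 : f x ≠ x) : Function.minimalPeriod f x = p :=
  haveI := Fact.mk hp
  Function.minimalPeriod_eq_prime (by rwa [Function.IsPeriodicPt, Perm.iterate_eq_pow]) h1

theorem sameCycle_conj_iff {D₁ D₂ : Type*} (e : D₁ ≃ D₂) {f : Perm D₁} {g : Perm D₂}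
    (h : ∀ x, e (f x) = g (e x)) (x y : D₁) :
    g.SameCycle (e x) (e y) ↔ f.SameCycle x y := by
  have hg : g = (e.symm.trans f).trans e := by
    ext z; simp [h]
  have hz : ∀ i : ℤ, ∀ x, (g ^ i) (e x) = e ((f ^ i) x) := by
    intro i x
    have h1 : ∀ n : ℕ, ∀ x, (g ^ n) (e x) = e ((f ^ n) x) := by
      intro n
      induction n with
      | zero => simp
      | succ n ih => intro x; rw [pow_succ, pow_succ, Perm.mul_apply, Perm.mul_apply, ← h, ih]
    cases i with
    | ofNat n => simpa using h1 n x
    | negSucc n =>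
      rw [zpow_negSucc, zpow_negSucc, Perm.inv_eq_iff_eq, h1, ← Perm.mul_apply, mul_inv_cancel,
        Perm.one_apply]
  simp only [Perm.SameCycle, hz, e.injective.eq_iff]

end Cycles

/-! ### Vertices, faces and connectedness of maps -/

namespace OrientedMap

variable {D : Type*} (M : OrientedMap D)

theorem rot_apply (d : D) : M.rot d = M.opp (M.next.symm d) := rfl

theorem vertex_eq_iff {x y : D} : M.vertex x = M.vertex y ↔ M.rot.SameCycle x y :=
  ⟨fun h => Quotient.exact h, fun h => Quotient.sound h⟩

theorem face_eq_iff {x y : D} : M.face x = M.face y ↔ M.next.SameCycle x y :=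
  ⟨fun h => Quotient.exact h, fun h => Quotient.sound h⟩

/-- The class of a dart under the generated equivalence is itself an invariant predicate. In this
form connectedness propagates a local property through the whole map. -/
theorem connected_iff : M.Connected ↔ ∀ Q : D → Prop, (∀ d, Q (M.next d) ↔ Q d) →
    (∀ d, Q (M.opp d) ↔ Q d) → ∀ x y, Q x → Q y := by
  constructor
  · intro h Q h1 h2 x y
    have : ∀ x y, Relation.EqvGen (fun a b => b = M.next a ∨ b = M.opp a) x y → (Q x ↔ Q y) := by
      intro x y hxy
      induction hxy with
      | rel a b hab => rcases hab with rfl | rfl <;> simp [h1, h2]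
      | refl => rfl
      | symm _ _ _ ih => exact ih.symm
      | trans _ _ _ _ _ ih1 ih2 => exact ih1.trans ih2
    exact (this x y (h x y)).1
  · intro h x y
    refine h (fun y => Relation.EqvGen _ x y) ?_ ?_ x y (.refl x)
    · intro d
      have hd : Relation.EqvGen (fun a b => b = M.next a ∨ b = M.opp a) d (M.next d) :=
        .rel _ _ (.inl rfl)
      exact ⟨fun hh => hh.trans _ _ _ (hd.symm _ _), fun hh => hh.trans _ _ _ hd⟩
    · intro d
      have hd : Relation.EqvGen (fun a b => b = M.next a ∨ b = M.opp a) d (M.opp d) :=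
        .rel _ _ (.inr rfl)
      exact ⟨fun hh => hh.trans _ _ _ (hd.symm _ _), fun hh => hh.trans _ _ _ hd⟩

theorem Pentagonal.pow_five {M : OrientedMap D} (h : M.Pentagonal) (d : D) :
    (M.next ^ 5) d = d := (h d).1

theorem Pentagonal.minimalPeriod_next {M : OrientedMap D} (h : M.Pentagonal) (d : D) :
    Function.minimalPeriod M.next d = 5 := by
  refine minimalPeriod_eq_of_prime _ Nat.prime_five (h d).1 fun h1 => ?_
  -- A dart fixed by `next` would put corners 0 and 1 of its tile at the same vertex.
  have := (h d).2 (a₁ := 0) (a₂ := 1) (by simp [h1])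
  exact absurd this (by decide)

open Classical in
noncomputable instance [Fintype D] : Fintype M.Vertex :=
  inferInstanceAs (Fintype (Quotient (Perm.SameCycle.setoid M.rot)))

theorem minimalPeriod_opp (d : D) : Function.minimalPeriod M.opp d = 2 :=
  minimalPeriod_eq_of_prime _ Nat.prime_two (by simp [pow_succ, M.opp_opp]) (M.opp_ne d)

end OrientedMap

/-! ### Counting labels over vertices and over tiles -/

namespace LabelledMap

variable {D D₁ D₂ L : Type*}

open Classical in
theorem cornersAt_vertex [Fintype D] (T : LabelledMap D L) (d : D) :
    T.cornersAt (T.vertex d) =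
      (Finset.univ.filter (fun y => T.rot.SameCycle d y)).val.map T.label := by
  unfold cornersAt
  congr 2
  ext y
  simp [T.vertex_eq_iff, Perm.sameCycle_comm]

theorem cornersAt_eq_map_range [Fintype D] (T : LabelledMap D L) (d : D) :
    T.cornersAt (T.vertex d) = (Multiset.range (Function.minimalPeriod T.rot d)).map
      (fun i => T.label ((T.rot ^ i) d)) := by
  classical
  rw [cornersAt_vertex, filter_sameCycle_val, Multiset.map_map]
  rfl

/-- Each corner lies at exactly one vertex. Combined with the count over tiles, this gives the
linear equations for the multiplicities of the vertex combinations. -/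
theorem sum_vertexCombinations [Fintype D] (T : LabelledMap D L) :
    T.vertexCombinations.sum = (Finset.univ : Finset D).val.map T.label := by
  classical
  have h1 : T.vertexCombinations.sum = ∑ v : T.Vertex, T.cornersAt v := by
    unfold vertexCombinations Finset.sum
    congr!
  rw [h1]
  ext a
  rw [Multiset.count_sum', Multiset.count_map, ← Finset.filter_val, ← Finset.card_def,
    Finset.card_eq_sum_card_fiberwise (f := T.vertex) (t := Finset.univ) (by simp [Set.MapsTo])]
  refine Finset.sum_congr rfl fun v _ => ?_
  unfold cornersAt
  rw [Multiset.count_map, ← Finset.filter_val, ← Finset.card_def]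
  congr 1
  ext y
  simp [and_comm]

theorem card_vertexCombinations [Fintype D] (T : LabelledMap D L) :
    T.vertexCombinations.card = Nat.card T.Vertex := by
  classical
  unfold vertexCombinations
  rw [Multiset.card_map, Nat.card_eq_fintype_card]
  rfl

theorem mem_vertexCombinations [Fintype D] (T : LabelledMap D L) (s : Multiset L) :
    s ∈ T.vertexCombinations ↔ ∃ d, T.cornersAt (T.vertex d) = s := by
  unfold vertexCombinations
  simp only [Multiset.mem_map, Finset.mem_val, Finset.mem_univ, true_and]
  constructor
  · rintro ⟨v, rfl⟩
    obtain ⟨d, rfl⟩ := Quotient.exists_rep v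
    exact ⟨d, rfl⟩
  · rintro ⟨d, rfl⟩
    exact ⟨_, rfl⟩

/-- Each label occurs in the whole tiling as often as in a tile, times the number of tiles. -/
theorem CongruentTo.count_labels [Fintype D] [DecidableEq L] {T : LabelledMap D L}
    {w : Fin 5 → L} (h : T.CongruentTo w) (a : L) :
    5 * ((Finset.univ : Finset D).val.map T.label).count a =
      Nat.card D * ((Finset.univ : Finset (Fin 5)).val.map w).count a := by
  have h1 : ∀ d, ∑ i : Fin 5, (if a = T.label ((T.next ^ (i : ℕ)) d) then 1 else 0) =
      ((Finset.univ : Finset (Fin 5)).val.map w).count a := by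
    intro d
    rw [Multiset.count_map, ← Finset.filter_val, ← Finset.card_def, Finset.card_filter]
    obtain ⟨k, hk | hk⟩ := h d
    · simp only [hk]
      exact Fintype.sum_equiv (Equiv.addLeft k) _ _ (fun _ => rfl)
    · simp only [hk]
      exact Fintype.sum_equiv (Equiv.subLeft k) _ _ (fun _ => rfl)
  have h2 : ∀ i : Fin 5, ∑ d, (if a = T.label ((T.next ^ (i : ℕ)) d) then 1 else 0) =
      ((Finset.univ : Finset D).val.map T.label).count a := by
    intro i
    rw [Multiset.count_map, ← Finset.filter_val, ← Finset.card_def, Finset.card_filter]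
    exact Fintype.sum_equiv (T.next ^ (i : ℕ)) _ _ (fun _ => rfl)
  -- Double count of the pairs (d, i) with label `a` at the i-th corner after d: summing over i
  -- first gives the count in a tile, summing over d first gives the total count.
  have h3 := Finset.sum_comm (s := (Finset.univ : Finset D)) (t := (Finset.univ : Finset (Fin 5)))
    (f := fun d i => (if a = T.label ((T.next ^ (i : ℕ)) d) then 1 else 0))
  simp only [h1, h2] at h3
  simpa using h3.symm

end LabelledMap

/-! ## Tilings with the combinations `α²β`, `α³`, `γⁿ` -/

/-- `{N α³βγ : N α²β, k α³, m γⁿ}` -/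
def avcOf (n N k m : ℕ) : AVC Label3 where
  numTiles := N
  tile := {.α, .α, .α, .β, .γ}
  vertices := Multiset.replicate N {.α, .α, .β} + Multiset.replicate k {.α, .α, .α} +
    Multiset.replicate m (Multiset.replicate n .γ)

/-- The label combinations `α²β`, `α³`, `γⁿ`. -/
def IsCombination (n : ℕ) (s : Multiset Label3) : Prop :=
  s = {.α, .α, .β} ∨ s = {.α, .α, .α} ∨ s = Multiset.replicate n .γ

theorem eq_replicate_of_isCombination {n : ℕ} {M : Multiset (Multiset Label3)}
    (h : ∀ s ∈ M, IsCombination n s) :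
    ∃ a b c, M = Multiset.replicate a {.α, .α, .β} + Multiset.replicate b {.α, .α, .α} +
      Multiset.replicate c (Multiset.replicate n .γ) := by
  induction M using Multiset.induction with
  | empty => exact ⟨0, 0, 0, by simp⟩
  | cons s M ih =>
    obtain ⟨a, b, c, hM⟩ := ih fun s hs => h s (Multiset.mem_cons_of_mem hs)
    rcases h s (Multiset.mem_cons_self s M) with hs | hs | hs
    · exact ⟨a + 1, b, c, by simp [hM, hs, Multiset.replicate_succ]⟩
    · exact ⟨a, b + 1, c, by simp [hM, hs, Multiset.replicate_succ]⟩
    · exact ⟨a, b, c + 1, by simp [hM, hs, Multiset.replicate_succ]⟩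

namespace LabelledMap

variable {D D₁ D₂ : Type*}

/-- The conditions for a tiling at the tiles and vertices, without the Euler characteristic
and the numbers of vertices. -/
structure IsLocalTiling [Fintype D] (T : LabelledMap D Label3) (n N : ℕ) : Prop where
  connected : T.Connected
  pentagonal : T.Pentagonal
  congruent : ∃ w : Fin 5 → Label3,
    (Finset.univ : Finset (Fin 5)).val.map w = {.α, .α, .α, .β, .γ} ∧ T.CongruentTo w
  corners : ∀ d, IsCombination n (T.cornersAt (T.vertex d))
  card : Nat.card D = 5 * N

/-- If the combinations α²β, α³, γⁿ occur a, b, c times, then counting β, α, γ gives a = N, 2a + 3b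
= 3N and nc = N, hence b = k and c = m. With 5N darts, twice Euler's formula reads 2(N + k + m) - 5N
+ 2N = 4, which is `hE`. -/
theorem isTilingFor_avcOf_iff [Fintype D] {T : LabelledMap D Label3} {n N k m : ℕ} (hn : 0 < n)
    (hk : N = 3 * k) (hm : N = n * m) (hE : 2 * k + 2 * m = N + 4) :
    T.IsTilingFor (avcOf n N k m) ↔ T.IsLocalTiling n N := by
  constructor
  · rintro ⟨h1, h2, h3, h4, h5⟩
    refine ⟨h1.1, h2, h3, ?_, ?_⟩
    · intro d
      have := (T.mem_vertexCombinations _).2 ⟨d, rfl⟩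
      rw [h5] at this
      simp only [avcOf, Multiset.mem_add, Multiset.mem_replicate] at this
      unfold IsCombination
      tauto
    · rw [card_eq_mul_card_cycles T.next 5 h2.minimalPeriod_next]
      exact congrArg _ h4
  · intro h
    obtain ⟨a, b, c, hM⟩ := eq_replicate_of_isCombination (n := n) (M := T.vertexCombinations) (by
      intro s hs
      obtain ⟨d, rfl⟩ := (T.mem_vertexCombinations _).1 hs
      exact h.corners d)
    obtain ⟨w, hw, hT⟩ := h.congruent
    have hF := card_eq_mul_card_cycles T.next 5 h.pentagonal.minimalPeriod_next
    have hEd := card_eq_mul_card_cycles T.opp 2 T.minimalPeriod_opp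
    have hV := T.card_vertexCombinations
    have hc : ∀ l, T.vertexCombinations.sum.count l =
        N * (({.α, .α, .α, .β, .γ} : Multiset Label3).count l) := by
      intro l
      have := hT.count_labels l
      rw [h.card, hw, ← T.sum_vertexCombinations, mul_assoc] at this
      exact Nat.eq_of_mul_eq_mul_left (by norm_num) this
    have hα := hc .α
    have hβ := hc .β
    have hγ := hc .γ
    simp [hM, Multiset.sum_replicate, Multiset.count_replicate, Multiset.count_nsmul,
      ← Multiset.cons_zero] at hα hβ hγ
    have ha : a = N := by omega
    have hb : b = k := by omega
    have hcm : c = m := by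
      rw [hm, mul_comm] at hγ
      exact Nat.eq_of_mul_eq_mul_left hn hγ
    subst ha hb hcm
    refine ⟨⟨h.connected, ?_⟩, h.pentagonal, ⟨w, hw, hT⟩, ?_, hM⟩
    · simp only [hM, Multiset.card_add, Multiset.card_replicate] at hV
      have hcd := h.card
      change (Nat.card T.Vertex : ℤ) - Nat.card (Quotient (Perm.SameCycle.setoid T.opp)) +
        Nat.card (Quotient (Perm.SameCycle.setoid T.next)) = 2
      omega
    · change Nat.card (Quotient (Perm.SameCycle.setoid T.next)) = a
      have hcd := h.card
      omega

/-! ### Invariance under mirror image and isomorphism -/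

theorem mirror_next_apply {L : Type*} (T : LabelledMap D L) (d : D) :
    T.mirror.next d = T.next.symm d := rfl

theorem mirror_opp_apply {L : Type*} (T : LabelledMap D L) (d : D) :
    T.mirror.opp d = T.next (T.opp (T.next.symm d)) := rfl

/-- A dart stands for the corner at its start, so keeping the corners while reversing the faces
forces `opp` to be conjugated by `next`. As a result vertices keep their corners and only the
direction of rotation changes. -/
theorem mirror_rot {L : Type*} (T : LabelledMap D L) : T.mirror.rot = T.rot.symm := by
  ext d
  rw [Equiv.eq_symm_apply, OrientedMap.rot_apply, OrientedMap.rot_apply]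
  simp [mirror, T.opp_opp]

theorem mirror_mirror {L : Type*} (T : LabelledMap D L) : T.mirror.mirror = T := by
  obtain ⟨⟨next, opp, h1, h2⟩, label⟩ := T
  simp only [mirror, LabelledMap.mk.injEq, OrientedMap.mk.injEq, and_true]
  exact ⟨rfl, by ext d; simp⟩

theorem mirror_sameCycle_rot {L : Type*} (T : LabelledMap D L) (x y : D) :
    T.mirror.rot.SameCycle x y ↔ T.rot.SameCycle x y := by
  rw [mirror_rot]; exact Perm.sameCycle_inv

theorem symm_pow_eq_of_pow_five {f : Perm D} (h : ∀ d, (f ^ 5) d = d) (i : Fin 5) (d : D) :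
    (f.symm ^ (i : ℕ)) d = (f ^ ((-i : Fin 5) : ℕ)) d := by
  have h5 : f ^ 5 = 1 := by ext d; simpa using h d
  change ((f⁻¹) ^ (i : ℕ)) d = _
  rw [inv_pow, Perm.inv_eq_iff_eq, ← Perm.mul_apply, ← pow_add]
  have : (i : ℕ) + ((-i : Fin 5) : ℕ) = 0 ∨ (i : ℕ) + ((-i : Fin 5) : ℕ) = 5 := by
    revert i; decide
  rcases this with h | h <;> simp [h, h5]

theorem IsLocalTiling.mirror [Fintype D] {T : LabelledMap D Label3} {n N : ℕ}
    (h : T.IsLocalTiling n N) : T.mirror.IsLocalTiling n N where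
  connected := by
    have hc := T.connected_iff.1 h.connected
    refine T.mirror.connected_iff.2 fun Q h1 h2 => ?_
    have hn : ∀ d, Q (T.next d) ↔ Q d := fun d => by
      simpa [mirror_next_apply] using (h1 (T.next d)).symm
    refine hc Q hn fun d => ?_
    have := h2 (T.next d)
    rw [mirror_opp_apply, hn, hn] at this
    simpa using this
  pentagonal := by
    intro d
    have h5 := h.pentagonal.pow_five
    constructor
    · have h1 : T.mirror.next ^ 5 = (T.next ^ 5)⁻¹ := (inv_pow T.next 5)
      rw [h1, Perm.inv_eq_iff_eq, h5]
    · intro i j hij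
      simp only [OrientedMap.vertex_eq_iff, mirror_sameCycle_rot] at hij
      change T.rot.SameCycle ((T.next.symm ^ (i : ℕ)) d) ((T.next.symm ^ (j : ℕ)) d) at hij
      rw [symm_pow_eq_of_pow_five h5, symm_pow_eq_of_pow_five h5, ← T.vertex_eq_iff] at hij
      exact neg_injective ((h.pentagonal d).2 hij)
  congruent := by
    obtain ⟨w, hw, hT⟩ := h.congruent
    refine ⟨w, hw, fun d => ?_⟩
    have h5 := h.pentagonal.pow_five
    obtain ⟨k, hk | hk⟩ := hT d
    · refine ⟨k, .inr fun i => ?_⟩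
      change T.label ((T.next.symm ^ (i : ℕ)) d) = _
      rw [symm_pow_eq_of_pow_five h5, hk, sub_eq_add_neg]
    · refine ⟨k, .inl fun i => ?_⟩
      change T.label ((T.next.symm ^ (i : ℕ)) d) = _
      rw [symm_pow_eq_of_pow_five h5, hk, sub_neg_eq_add]
  corners := by
    classical
    intro d
    have := h.corners d
    rw [cornersAt_vertex] at this ⊢
    simp only [mirror_sameCycle_rot]
    exact this
  card := h.card

theorem adjacentInTile_mirror {L : Type*} (T : LabelledMap D L) {a b : L} :
    T.mirror.AdjacentInTile a b ↔ T.AdjacentInTile a b := by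
  have key : ∀ T : LabelledMap D L, T.AdjacentInTile a b → T.mirror.AdjacentInTile a b := by
    rintro T ⟨d, h⟩
    refine ⟨T.next d, ?_⟩
    rw [mirror_next_apply, Equiv.symm_apply_apply]
    exact h.symm.imp And.symm And.symm
  exact ⟨fun h => by simpa [mirror_mirror] using key _ h, key T⟩

theorem DirectIso.symm {L : Type*} {T₁ : LabelledMap D₁ L} {T₂ : LabelledMap D₂ L}
    (h : DirectIso T₁ T₂) : DirectIso T₂ T₁ := by
  obtain ⟨f, h1, h2, h3⟩ := h
  refine ⟨f.symm, fun d => ?_, fun d => ?_, fun d => ?_⟩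
  · rw [Equiv.symm_apply_eq, h1, Equiv.apply_symm_apply]
  · rw [Equiv.symm_apply_eq, h2, Equiv.apply_symm_apply]
  · rw [← h3, Equiv.apply_symm_apply]

theorem DirectIso.mirror {L : Type*} {T₁ : LabelledMap D₁ L} {T₂ : LabelledMap D₂ L}
    (h : DirectIso T₁ T₂) : DirectIso T₁.mirror T₂.mirror := by
  obtain ⟨f, h1, h2, h3⟩ := h
  have h1' : ∀ d, f (T₁.next.symm d) = T₂.next.symm (f d) := fun d => by
    rw [Equiv.eq_symm_apply, ← h1, Equiv.apply_symm_apply]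
  exact ⟨f, h1', fun d => by rw [mirror_opp_apply, mirror_opp_apply, h1, h2, h1'], h3⟩

theorem DirectIso.adjacentInTile {L : Type*} {T₁ : LabelledMap D₁ L} {T₂ : LabelledMap D₂ L}
    (h : DirectIso T₁ T₂) {a b : L} (hT : T₁.AdjacentInTile a b) : T₂.AdjacentInTile a b := by
  obtain ⟨f, h1, -, h3⟩ := h
  obtain ⟨d, hd⟩ := hT
  exact ⟨f d, by simpa only [← h1, h3] using hd⟩

theorem DirectIso.isLocalTiling [Fintype D₁] [Fintype D₂] {T₁ : LabelledMap D₁ Label3}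
    {T₂ : LabelledMap D₂ Label3} (h : DirectIso T₁ T₂) {n N : ℕ} (hT : T₁.IsLocalTiling n N) :
    T₂.IsLocalTiling n N := by
  obtain ⟨f, h1, h2, h3⟩ := h
  have h1' : ∀ d, f (T₁.next.symm d) = T₂.next.symm (f d) := fun d => by
    rw [Equiv.eq_symm_apply, ← h1, Equiv.apply_symm_apply]
  have hrot : ∀ d, f (T₁.rot d) = T₂.rot (f d) := fun d => by
    rw [OrientedMap.rot_apply, OrientedMap.rot_apply, h2, h1']
  have hcyc := sameCycle_conj_iff f hrot
  have hpow : ∀ i : ℕ, ∀ d, (T₂.next ^ i) (f d) = f ((T₁.next ^ i) d) := by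
    intro i
    induction i with
    | zero => simp
    | succ i ih => intro d; rw [pow_succ, pow_succ, Perm.mul_apply, Perm.mul_apply, ← h1, ih]
  refine ⟨?_, ?_, ?_, ?_, ?_⟩
  · have hc := T₁.connected_iff.1 hT.connected
    refine T₂.connected_iff.2 fun Q q1 q2 x y hx => ?_
    have := hc (fun d => Q (f d)) (fun d => by rw [h1, q1]) (fun d => by rw [h2, q2])
      (f.symm x) (f.symm y) (by simpa using hx)
    simpa using this
  · intro d
    obtain ⟨d, rfl⟩ := f.surjective d
    refine ⟨by rw [hpow, hT.pentagonal.pow_five], fun i j hij => (hT.pentagonal d).2 ?_⟩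
    simpa only [OrientedMap.vertex_eq_iff, hpow, hcyc] using hij
  · obtain ⟨w, hw, hc⟩ := hT.congruent
    refine ⟨w, hw, fun d => ?_⟩
    obtain ⟨d, rfl⟩ := f.surjective d
    simpa only [hpow, h3] using hc d
  · classical
    intro d
    obtain ⟨d, rfl⟩ := f.surjective d
    have := hT.corners d
    rw [cornersAt_vertex] at this ⊢
    convert this using 1
    have hmap : Finset.univ.filter (fun y => T₂.rot.SameCycle (f d) y) =
        (Finset.univ.filter (fun y => T₁.rot.SameCycle d y)).map f.toEmbedding := by
      ext y
      obtain ⟨y, rfl⟩ := f.surjective y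
      simp [hcyc]
    rw [hmap, Finset.map_val, Multiset.map_map]
    exact Multiset.map_congr rfl fun x _ => h3 x
  · rw [← hT.card]; exact Nat.card_congr f.symm

theorem Same.symm {L : Type*} {T₁ : LabelledMap D₁ L} {T₂ : LabelledMap D₂ L}
    (h : Same T₁ T₂) : Same T₂ T₁ := by
  rcases h with h | h
  · exact .inl h.symm
  · have := h.symm.mirror
    rw [mirror_mirror] at this
    exact .inr this

theorem Same.isLocalTiling [Fintype D₁] [Fintype D₂] {T₁ : LabelledMap D₁ Label3}
    {T₂ : LabelledMap D₂ Label3} (h : Same T₁ T₂) {n N : ℕ} (hT : T₂.IsLocalTiling n N) :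
    T₁.IsLocalTiling n N :=
  h.elim (fun h => h.symm.isLocalTiling hT) fun h => h.symm.isLocalTiling hT.mirror

theorem Same.adjacentInTile_iff {L : Type*} {T₁ : LabelledMap D₁ L} {T₂ : LabelledMap D₂ L}
    (h : Same T₁ T₂) {a b : L} : T₁.AdjacentInTile a b ↔ T₂.AdjacentInTile a b := by
  rcases h with h | h
  · exact ⟨h.adjacentInTile, h.symm.adjacentInTile⟩
  · rw [← T₂.adjacentInTile_mirror]
    exact ⟨h.adjacentInTile, h.symm.adjacentInTile⟩

end LabelledMap

/-! ## Pentagonal maps with a centre in each tile -/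

namespace OrientedMap

variable {D : Type*}

theorem rot_next (M : OrientedMap D) (d : D) : M.rot (M.next d) = M.opp d := by
  rw [rot_apply, Equiv.symm_apply_apply]

/-- Each tile is a pentagon with one distinguished corner, from which the positions `pos` of its
corners are counted. All corners at a vertex are distinguished, or none is, and in the latter case
the vertex has degree `3` (or `1`). -/
structure IsCentred (M : OrientedMap D) (pos : D → Fin 5) : Prop where
  next_five : ∀ d, (M.next ^ 5) d = d
  pos_next : ∀ d, pos (M.next d) = pos d + 1
  pos_rot : ∀ d, pos (M.rot d) = 0 ↔ pos d = 0
  rot_three : ∀ d, pos d ≠ 0 → M.rot (M.rot (M.rot d)) = d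

namespace IsCentred

variable {M : OrientedMap D} {pos : D → Fin 5} (h : M.IsCentred pos)

include h

theorem pos_next_symm (d : D) : pos (M.next.symm d) = pos d - 1 := by
  rw [eq_sub_iff_add_eq, ← h.pos_next, Equiv.apply_symm_apply]

theorem pos_next_pow (i : Fin 5) (d : D) : pos ((M.next ^ (i : ℕ)) d) = pos d + i := by
  fin_cases i <;> simp [pow_succ, h.pos_next, add_assoc]

/-- The corner after `opp d` is at the same vertex as `d`, so it is again a centre. -/
theorem pos_opp_of_zero {d : D} (hd : pos d = 0) : pos (M.opp d) = 4 := by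
  have h1 := (h.pos_rot (M.next (M.opp d))).1 (by rw [M.rot_next, M.opp_opp, hd])
  rw [h.pos_next] at h1
  generalize pos (M.opp d) = x at *
  revert x; decide

theorem pos_opp_of_four {d : D} (hd : pos d = 4) : pos (M.opp d) = 0 := by
  rw [← M.rot_next, h.pos_rot, h.pos_next, hd]; rfl

theorem pos_rot_eq_four {d : D} : pos (M.rot d) = 4 ↔ pos d = 1 := by
  constructor
  · intro hd
    have h1 := h.pos_opp_of_four hd
    rw [rot_apply, M.opp_opp, h.pos_next_symm] at h1
    generalize pos d = x at *
    revert x; decide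
  · intro hd
    rw [rot_apply]
    exact h.pos_opp_of_zero (by rw [h.pos_next_symm, hd]; rfl)

/-- The vertex has degree 3, and positions 1 and 4 follow each other around it: `rot` leads to
position 4 exactly from position 1. The third corner can therefore be neither 1 nor 4, and it is not
a centre. -/
theorem pos_rot_rot {d : D} (hd : pos d = 1) :
    pos (M.rot (M.rot d)) = 2 ∨ pos (M.rot (M.rot d)) = 3 := by
  have h3 := h.rot_three d (by rw [hd]; decide)
  have h0 : pos (M.rot (M.rot d)) ≠ 0 := by
    rw [Ne, h.pos_rot, h.pos_rot, hd]; decide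
  have h1 : pos (M.rot (M.rot d)) ≠ 1 := by
    rw [Ne, ← h.pos_rot_eq_four, h3, hd]; decide
  have h4 : pos (M.rot (M.rot d)) ≠ 4 := by
    rw [Ne, h.pos_rot_eq_four, h.pos_rot_eq_four.2 hd]; decide
  generalize pos (M.rot (M.rot d)) = x at *
  revert x; decide

theorem opp_eq_of_pos_eq_one {d : D} (hd : pos d = 1) :
    M.opp d = M.next.symm (M.rot (M.rot d)) := by
  have h3 := h.rot_three d (by rw [hd]; decide)
  rw [M.rot_apply (M.rot (M.rot d))] at h3
  rw [← h3, M.opp_opp, h3]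

theorem pos_opp_of_one {d : D} (hd : pos d = 1) :
    pos (M.opp d) = pos (M.rot (M.rot d)) - 1 := by
  rw [h.opp_eq_of_pos_eq_one hd, h.pos_next_symm]

theorem pos_opp_of_one_or {d : D} (hd : pos d = 1) : pos (M.opp d) = 1 ∨ pos (M.opp d) = 2 := by
  rw [h.pos_opp_of_one hd]
  rcases h.pos_rot_rot hd with h1 | h1 <;> rw [h1] <;> decide

/-- The corner at position `1` at the other end of the edge that arrives at position `4`. -/
theorem exists_rot_eq_next {x : D} (hx : pos x = 3) :
    pos (M.next (M.opp (M.next x))) = 1 ∧ M.rot (M.rot (M.next (M.opp (M.next x)))) = M.opp x := by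
  have h4 : pos (M.next x) = 4 := by rw [h.pos_next, hx]; rfl
  refine ⟨by rw [h.pos_next, h.pos_opp_of_four h4]; rfl, ?_⟩
  rw [M.rot_next, M.opp_opp, M.rot_next]

/-- The dart `d` does not end at a centre, so its end has degree 3, and the third corner there
closes the rotation. -/
theorem opp_next {d : D} (hd : pos d ≠ 4) :
    M.opp (M.next d) = M.next.symm (M.rot (M.opp d)) := by
  have h3 := h.rot_three (M.next d) (by
    rw [h.pos_next]; generalize pos d = x at *; revert x; decide)
  rw [M.rot_next, M.rot_apply (M.rot _)] at h3
  rw [← h3, M.opp_opp]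

/-- Suppose that the edge `d` joins the positions `1, 2` of its tile to the positions `2, 3` of
the tile on the other side. Then the same holds for the tiles across the four edges
from position `1` to position `4` and back to the centre. -/
theorem pos_opp_step {d : D} (hd : pos d = 1) (hA : pos (M.opp d) = 2) :
    pos (M.opp (M.next.symm (M.opp d))) = 2 ∧
    (pos (M.opp (M.next d)) = 1 ∧ pos (M.opp (M.opp (M.next d))) = 2) ∧
    pos (M.opp (M.next (M.next d))) = 3 := by
  have hs1 : pos (M.next.symm (M.opp d)) = 1 := by rw [h.pos_next_symm, hA]; rfl
  have hν : pos (M.next d) = 2 := by rw [h.pos_next, hd]; rfl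
  have h3 := h.rot_three (M.next d) (by rw [hν]; decide)
  rw [M.rot_next] at h3
  -- This dart is the third corner at the end of `d`, where the other two corners have position 2.
  -- Position 1 would put position 4 next in the rotation, but the next corner is `next d`. Hence
  -- all three positions are 2: a vertex of P.
  have hd1 : pos (M.opp (M.next.symm (M.opp d))) = 2 := by
    refine (h.pos_opp_of_one_or hs1).resolve_left fun h1 => ?_
    rw [← M.rot_apply, ← h.pos_rot_eq_four, h3, hν] at h1
    exact absurd h1 (by decide)
  have ho := h.opp_next (d := d) (by rw [hd]; decide)
  have hp1 : pos (M.opp (M.next d)) = 1 := by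
    rw [ho, h.pos_next_symm, M.rot_apply, hd1]; rfl
  refine ⟨hd1, ⟨hp1, by rw [M.opp_opp, hν]⟩, ?_⟩
  rw [h.opp_next (by rw [hν]; decide), h.pos_next_symm, h.pos_rot_eq_four.2 hp1]; rfl

theorem exists_eq_next_pow (d : D) (i : Fin 5) :
    ∃ (e : D) (j : Fin 5), pos e = i ∧ (M.next ^ (j : ℕ)) e = d := by
  refine ⟨(M.next ^ ((i - pos d : Fin 5) : ℕ)) d, pos d - i, ?_, ?_⟩
  · rw [h.pos_next_pow, add_sub_cancel]
  · rw [← Perm.mul_apply, ← pow_add]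
    have : ∀ x y : Fin 5, ((x - y : Fin 5) : ℕ) + ((y - x : Fin 5) : ℕ) = 0 ∨
        ((x - y : Fin 5) : ℕ) + ((y - x : Fin 5) : ℕ) = 5 := by decide
    rcases this (pos d) i with h1 | h1 <;> rw [h1]
    · simp
    · exact h.next_five d

theorem next_symm_eq (d : D) : M.next.symm d = M.next (M.next (M.next (M.next d))) := by
  rw [Equiv.symm_apply_eq]
  have := h.next_five d
  simpa [pow_succ] using this.symm

/-- The tiles glued in the first way form a set closed under crossing any of the five edges, so by
connectedness it is empty or everything. -/
theorem pos_opp_one_dichotomy [Finite D] (hM : M.Connected) :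
    (∀ d, pos d = 1 → pos (M.opp d) = 2) ∨ (∀ d, pos d = 1 → pos (M.opp d) = 1) := by
  by_cases hex : ∃ d, pos d = 1 ∧ pos (M.opp d) = 2
  swap
  · push Not at hex
    exact .inr fun d hd => (h.pos_opp_of_one_or hd).resolve_right (hex d hd)
  left
  obtain ⟨d₀, h1, h2⟩ := hex
  -- the tiles with this property, given by any of their corners
  let Q : D → Prop := fun x => pos (M.opp ((M.next ^ ((1 - pos x : Fin 5) : ℕ)) x)) = 2
  have hQ1 : ∀ d, pos d = 1 → (Q d ↔ pos (M.opp d) = 2) := fun d hd => by simp [Q, hd]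
  have hQn : ∀ d, Q (M.next d) ↔ Q d := by
    intro d
    have : (M.next ^ ((1 - pos (M.next d) : Fin 5) : ℕ)) (M.next d) =
        (M.next ^ ((1 - pos d : Fin 5) : ℕ)) d := by
      rw [h.pos_next, ← Perm.mul_apply, ← pow_succ]
      have hx : ∀ x : Fin 5, ((1 - (x + 1) : Fin 5) : ℕ) + 1 = ((1 - x : Fin 5) : ℕ) ∨
          (((1 - (x + 1) : Fin 5) : ℕ) + 1 = 5 ∧ ((1 - x : Fin 5) : ℕ) = 0) := by decide
      rcases hx (pos d) with hx | ⟨hx, hx'⟩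
      · rw [hx]
      · rw [hx, hx', h.next_five]; simp
    simp only [Q, this]
  have hQs : ∀ d, Q (M.next.symm d) ↔ Q d := fun d => by
    rw [← hQn, Equiv.apply_symm_apply]
  -- crossing the edges that end at the centre
  let φ : Perm D := ((M.next.trans (M.next.trans M.next)).trans M.opp).trans M.next
  have hφ : ∀ d, φ d = M.next (M.opp (M.next (M.next (M.next d)))) := fun _ => rfl
  have hφQ : ∀ d, (pos d = 1 ∧ Q d) → (pos (φ d) = 1 ∧ Q (φ d)) := by
    rintro d ⟨hd, hA⟩
    have hx : pos (M.next (M.next d)) = 3 := by rw [h.pos_next, h.pos_next, hd]; rfl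
    obtain ⟨k1, k2⟩ := h.exists_rot_eq_next hx
    refine ⟨k1, (hQ1 _ k1).2 ?_⟩
    rw [h.pos_opp_of_one k1, k2, (h.pos_opp_step hd ((hQ1 d hd).1 hA)).2.2]; rfl
  -- `φ` turns one step around the centre, and only this direction comes from `pos_opp_step`.
  -- Finiteness supplies the other direction, needed to cross the edge that starts at the centre.
  have hφQ' : ∀ d, (pos d = 1 ∧ Q d) → (pos (φ.symm d) = 1 ∧ Q (φ.symm d)) := fun d hd =>
    Perm.perm_symm_on_of_perm_on_finite (p := fun d => pos d = 1 ∧ Q d) (f := φ)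
      (fun x hx => hφQ x hx) hd
  have hφi : ∀ d, M.next (M.next (M.next (φ.symm d))) = M.opp (M.next.symm d) := by
    intro d
    have : φ (φ.symm d) = d := by simp
    rw [hφ] at this
    rw [← M.opp_opp (M.next (M.next (M.next (φ.symm d)))), ← this, Equiv.symm_apply_apply, this]
  have hzero : ∀ d, pos d = 1 → Q d → Q (M.opp (M.next.symm d)) := by
    intro d hd hA
    rw [← hφi, hQn, hQn, hQn]
    exact (hφQ' d ⟨hd, hA⟩).2
  have hQo : ∀ x, Q x → Q (M.opp x) := by
    intro x hx
    obtain ⟨d, i, hd, rfl⟩ := h.exists_eq_next_pow x 1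
    have hA : Q d := by
      have hi : ∀ i : ℕ, ∀ d, Q ((M.next ^ i) d) ↔ Q d := by
        intro i
        induction i with
        | zero => simp
        | succ i ih => intro d; rw [pow_succ', Perm.mul_apply, hQn, ih]
      exact (hi _ _).1 hx
    have hA' := (hQ1 d hd).1 hA
    obtain ⟨s1, ⟨s2, s3⟩, s4⟩ := h.pos_opp_step hd hA'
    have hs1 : pos (M.next.symm (M.opp d)) = 1 := by rw [h.pos_next_symm, hA']; rfl
    clear hx
    fin_cases i
    · change Q (M.opp d)
      rw [← hQs, hQ1 _ hs1]; exact s1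
    · change Q (M.opp (M.next d))
      rw [hQ1 _ s2]; exact s3
    · change Q (M.opp (M.next (M.next d)))
      rw [h.opp_next (by rw [h.pos_next, hd]; decide), hQs, M.rot_apply]
      exact hzero _ s2 ((hQ1 _ s2).2 s3)
    · change Q (M.opp (M.next (M.next (M.next d))))
      rw [← hQn, ← hφ]
      exact (hφQ d ⟨hd, hA⟩).2
    · change Q (M.opp (M.next (M.next (M.next (M.next d)))))
      rw [← h.next_symm_eq]
      exact hzero d hd hA
  intro d hd
  refine (hQ1 d hd).1 (M.connected_iff.1 hM Q hQn (fun x => ⟨fun hx => ?_, hQo x⟩) d₀ d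
    ((hQ1 _ h1).2 h2))
  have := hQo _ hx
  rwa [M.opp_opp] at this

end IsCentred

theorem _root_.PentTiling.LabelledMap.isCentred_mirror {L : Type*} {T : LabelledMap D L}
    {pos : D → Fin 5} (h : T.IsCentred pos) : T.mirror.IsCentred (fun d => -pos d) where
  next_five d := by
    have h1 : T.mirror.next ^ 5 = (T.next ^ 5)⁻¹ := inv_pow T.next 5
    rw [h1, Perm.inv_eq_iff_eq, h.next_five]
  pos_next d := by
    rw [LabelledMap.mirror_next_apply, h.pos_next_symm, neg_sub, sub_eq_neg_add]
  pos_rot d := by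
    rw [T.mirror_rot, neg_eq_zero, neg_eq_zero, ← h.pos_rot, Equiv.apply_symm_apply]
  rot_three d hd := by
    rw [T.mirror_rot, Equiv.symm_apply_eq, Equiv.symm_apply_eq, Equiv.symm_apply_eq,
      h.rot_three d (by simpa using hd)]

/-- If the edges from position `1` to `2` are not glued as in a pentagonal subdivision, then they are
in the mirror image. -/
theorem IsCentred.pos_opp_mirror {L : Type*} {T : LabelledMap D L} {pos : D → Fin 5}
    (h : T.IsCentred pos) (hB : ∀ d, pos d = 1 → pos (T.opp d) = 1) (d : D) (hd : -pos d = 1) :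
    -pos (T.mirror.opp d) = 2 := by
  have hx : pos (T.next.symm d) = 3 := by
    rw [h.pos_next_symm]
    generalize pos d = x at *
    revert x; decide
  obtain ⟨k1, k2⟩ := h.exists_rot_eq_next hx
  have k3 := h.pos_opp_of_one k1
  rw [hB _ k1, k2] at k3
  rw [LabelledMap.mirror_opp_apply, h.pos_next]
  generalize pos (T.opp (T.next.symm d)) = x at *
  revert x; decide

end OrientedMap

/-! ### Recovering the subdivided map -/

namespace OrientedMap

variable {D : Type*}

theorem IsCentred.pos_opp_of_three {M : OrientedMap D} {pos : D → Fin 5} (h : M.IsCentred pos)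
    (hA : ∀ d, pos d = 1 → pos (M.opp d) = 2) {x : D} (hx : pos x = 3) : pos (M.opp x) = 3 := by
  obtain ⟨k1, k2⟩ := h.exists_rot_eq_next hx
  have k3 := h.pos_opp_of_one k1
  rw [hA _ k1, k2] at k3
  generalize pos (M.opp x) = y at *
  revert y; decide

/-- A centred map with the edges glued as in a pentagonal subdivision is one, of the map with
the distinguished corners as its darts. -/
theorem IsCentred.exists_pentSub {M : OrientedMap D} {pos : D → Fin 5} (h : M.IsCentred pos)
    (hA : ∀ d, pos d = 1 → pos (M.opp d) = 2) :
    ∃ (P : OrientedMap {d // pos d = 0}) (f : {d // pos d = 0} × Fin 5 ≃ D),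
      (∀ x, f ((pentSub P).next x) = M.next (f x)) ∧
      (∀ x, f ((pentSub P).opp x) = M.opp (f x)) ∧
      (∀ x, pos (f x) = x.2) ∧ (∀ g, (P.next g : D) = M.rot g) ∧ P.rot ^ 3 = 1 := by
  let τ : Perm D := (M.next ^ 3).trans (M.opp.trans (M.next ^ 3).symm)
  have hτ : ∀ d, (M.next ^ 3) (τ d) = M.opp ((M.next ^ 3) d) := fun d => by simp [τ]
  have hττ : ∀ d, τ (τ d) = d := fun d => by
    apply (M.next ^ 3).injective
    rw [hτ, hτ, M.opp_opp]
  have hτ0 : ∀ d, pos d = 0 → pos (τ d) = 0 := fun d hd => by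
    have h3 := h.pos_next_pow 3
    have h1 : pos (M.opp ((M.next ^ 3) d)) = 3 :=
      h.pos_opp_of_three hA ((h3 d).trans (by rw [hd, zero_add]))
    rw [← hτ] at h1
    have h2 := (h3 (τ d)).symm.trans h1
    simpa using h2
  have hτ0' : ∀ d, pos (τ d) = 0 ↔ pos d = 0 := fun d =>
    ⟨fun hd => by rw [← hττ d]; exact hτ0 _ hd, hτ0 d⟩
  let P : OrientedMap {d // pos d = 0} :=
    { next := M.rot.subtypePerm h.pos_rot
      opp := τ.subtypePerm hτ0'
      opp_opp := fun g => Subtype.ext (hττ g)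
      opp_ne := fun g hg => M.opp_ne ((M.next ^ 3) (g : D)) (by
        rw [← hτ]; exact congrArg _ (congrArg Subtype.val hg)) }
  have hPn : ∀ g, (P.next g : D) = M.rot g := fun _ => rfl
  have hPo : ∀ g, (P.opp g : D) = τ g := fun _ => rfl
  let F : {d // pos d = 0} × Fin 5 → D := fun x => (M.next ^ (x.2 : ℕ)) (x.1 : D)
  have hFpos : ∀ x, pos (F x) = x.2 := fun x => by
    change pos ((M.next ^ (x.2 : ℕ)) (x.1 : D)) = _
    rw [h.pos_next_pow, x.1.2, zero_add]
  have hFb : Function.Bijective F := by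
    constructor
    · rintro ⟨g, i⟩ ⟨g', j⟩ hx
      have h2 : i = j := by
        have := congrArg pos hx
        rwa [hFpos, hFpos] at this
      subst h2
      exact congrArg (·, i) (Subtype.ext ((M.next ^ (i : ℕ)).injective hx))
    · intro d
      obtain ⟨e, i, he, hd⟩ := h.exists_eq_next_pow d 0
      exact ⟨(⟨e, he⟩, i), hd⟩
  have h4 : ∀ d, (M.next ^ 4) d = M.next.symm d := fun d => by
    rw [h.next_symm_eq]; simp [pow_succ]
  -- The right side is also `M.rot` of the corner at position 2, so two steps of `next` carry
  -- rotation in P to rotation around the vertices of degree 3. This gives `P.rot ^ 3 = 1` below.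
  have hσ : ∀ g, (M.next ^ 2) (P.rot g : D) = M.opp (M.next (g : D)) := by
    intro g
    obtain ⟨g', rfl⟩ := P.next.surjective g
    rw [P.rot_next, hPo, hPn]
    have hd : pos (M.next (M.rot (g' : D))) = 1 := by
      rw [h.pos_next, (h.pos_rot _).2 g'.2, zero_add]
    have he : M.opp (M.rot (g' : D)) = M.next ((M.next ^ 3) (g' : D)) := by
      rw [M.rot_apply, M.opp_opp, ← h4, pow_succ', Perm.mul_apply]
    rw [h.opp_eq_of_pos_eq_one hd, Equiv.eq_symm_apply, M.rot_next, he, M.rot_next, ← hτ,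
      ← Perm.mul_apply, ← pow_succ']
  refine ⟨P, Equiv.ofBijective F hFb, ?_, ?_, hFpos, hPn, ?_⟩
  · rintro ⟨g, i⟩
    change F (g, i + 1) = M.next (F (g, i))
    fin_cases i
    · rfl
    · rfl
    · rfl
    · rfl
    · change (g : D) = M.next ((M.next ^ 4) (g : D))
      rw [h4, Equiv.apply_symm_apply]
  · rintro ⟨g, i⟩
    fin_cases i
    · change (M.next ^ 4) (P.next.symm g : D) = M.opp (g : D)
      obtain ⟨g', rfl⟩ := P.next.surjective g
      rw [Equiv.symm_apply_apply, h4, hPn, M.rot_apply, M.opp_opp]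
    · exact hσ g
    · change M.next (P.rot.symm g : D) = M.opp ((M.next ^ 2) (g : D))
      obtain ⟨g', rfl⟩ := P.rot.surjective g
      rw [Equiv.symm_apply_apply, hσ, M.opp_opp]
    · exact hτ g
    · change M.rot (g : D) = M.opp ((M.next ^ 4) (g : D))
      rw [h4, M.rot_apply]
  · ext g
    apply (M.next ^ 2).injective
    have hr : ∀ g, (M.next ^ 2) (P.rot g : D) = M.rot ((M.next ^ 2) (g : D)) := fun g => by
      rw [hσ, pow_two, Perm.mul_apply, M.rot_next]
    have hp : pos ((M.next ^ 2) (g : D)) ≠ 0 := by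
      have := h.pos_next_pow 2 g
      rw [g.2] at this
      exact fun h0 => absurd (this.symm.trans h0) (by decide)
    change (M.next ^ 2) (P.rot (P.rot (P.rot g)) : D) = _
    rw [hr, hr, hr, h.rot_three _ hp]; rfl

end OrientedMap

/-! ### The corners γ as centres -/

namespace LabelledMap

variable {D : Type*} [Fintype D] {T : LabelledMap D Label3} {n N : ℕ}

theorem label_mem_cornersAt {L : Type*} (T : LabelledMap D L) {d e : D}
    (hde : T.rot.SameCycle d e) : T.label e ∈ T.cornersAt (T.vertex d) := by
  classical
  rw [cornersAt_vertex]
  exact Multiset.mem_map_of_mem _ (by simpa using hde)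

theorem card_cornersAt {L : Type*} (T : LabelledMap D L) (d : D) :
    (T.cornersAt (T.vertex d)).card = Function.minimalPeriod T.rot d := by
  rw [cornersAt_eq_map_range]; simp

namespace IsLocalTiling

variable (h : T.IsLocalTiling n N)

include h

theorem cornersAt_of_label_eq_γ {d : D} (hd : T.label d = .γ) :
    T.cornersAt (T.vertex d) = Multiset.replicate n .γ := by
  have := T.label_mem_cornersAt (Perm.SameCycle.refl _ d)
  rw [hd] at this
  rcases h.corners d with h1 | h1 | h1
  · simp [h1] at this
  · simp [h1] at this
  · exact h1

theorem label_eq_γ_of_sameCycle {d e : D} (hde : T.rot.SameCycle d e) (hd : T.label d = .γ) :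
    T.label e = .γ := by
  have := T.label_mem_cornersAt hde
  rw [h.cornersAt_of_label_eq_γ hd] at this
  exact Multiset.eq_of_mem_replicate this

theorem label_rot_eq_γ (d : D) : T.label (T.rot d) = .γ ↔ T.label d = .γ :=
  ⟨h.label_eq_γ_of_sameCycle ⟨-1, by simp⟩, h.label_eq_γ_of_sameCycle ⟨1, by simp⟩⟩

theorem minimalPeriod_of_label_eq_γ {d : D} (hd : T.label d = .γ) :
    Function.minimalPeriod T.rot d = n := by
  rw [← T.card_cornersAt, h.cornersAt_of_label_eq_γ hd, Multiset.card_replicate]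

theorem minimalPeriod_of_label_ne_γ {d : D} (hd : T.label d ≠ .γ) :
    Function.minimalPeriod T.rot d = 3 := by
  have hm := T.label_mem_cornersAt (Perm.SameCycle.refl _ d)
  rw [← T.card_cornersAt]
  rcases h.corners d with h1 | h1 | h1
  · rw [h1]; rfl
  · rw [h1]; rfl
  · rw [h1] at hm
    exact absurd (Multiset.eq_of_mem_replicate hm) hd

/-- There is at most one corner `β` at a vertex. -/
theorem eq_of_label_eq_β {d e : D} (hde : T.rot.SameCycle d e) (hd : T.label d = .β)
    (he : T.label e = .β) : d = e := by
  classical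
  have hc : (T.cornersAt (T.vertex d)).count .β ≤ 1 := by
    rcases h.corners d with h1 | h1 | h1 <;> rw [h1]
    · decide
    · decide
    · simp [Multiset.count_replicate]
  rw [cornersAt_vertex, Multiset.count_map, ← Finset.filter_val, ← Finset.card_def,
    Finset.card_le_one] at hc
  exact hc _ (by simpa [hd] using Perm.SameCycle.refl _ _) _ (by simp [hde, he])

/-- The position of `β` in the tiles, relative to `γ` and up to reflection. -/
theorem exists_tile_labels : ∃ c : Fin 5, c ≠ 0 ∧
    (∀ d, ∃ i : Fin 5, T.label ((T.next ^ (i : ℕ)) d) = .γ) ∧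
    ∀ d, T.label d = .γ → (∀ i : Fin 5, T.label ((T.next ^ (i : ℕ)) d) = .γ ↔ i = 0) ∧
      ((∀ i : Fin 5, T.label ((T.next ^ (i : ℕ)) d) = .β ↔ i = c) ∨
        (∀ i : Fin 5, T.label ((T.next ^ (i : ℕ)) d) = .β ↔ i = -c)) := by
  obtain ⟨w, hw, hc⟩ := h.congruent
  have key : ∀ a : Label3, ({.α, .α, .α, .β, .γ} : Multiset Label3).count a = 1 →
      ∃ i, ∀ j, w j = a ↔ j = i := by
    intro a ha
    rw [← hw, Multiset.count_map, ← Finset.filter_val, ← Finset.card_def,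
      Finset.card_eq_one] at ha
    obtain ⟨i, hi⟩ := ha
    refine ⟨i, fun j => ?_⟩
    have := Finset.ext_iff.1 hi j
    simpa [eq_comm] using this
  obtain ⟨i₀, hi⟩ := key .γ (by decide)
  obtain ⟨j₀, hj⟩ := key .β (by decide)
  -- The constant c is the offset from γ to β in the prototile; tiles read backward have offset -c.
  refine ⟨j₀ - i₀, ?_, ?_, ?_⟩
  · rw [sub_ne_zero]
    rintro rfl
    have h1 := (hi j₀).2 rfl
    rw [(hj j₀).2 rfl] at h1
    cases h1
  · intro d
    obtain ⟨k, hk | hk⟩ := hc d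
    · exact ⟨i₀ - k, by rw [hk, hi, add_sub_cancel]⟩
    · exact ⟨k - i₀, by rw [hk, hi, sub_sub_cancel]⟩
  · intro d hd
    obtain ⟨k, hk | hk⟩ := hc d
    · have h0 := hk 0
      rw [Fin.val_zero, pow_zero, Perm.one_apply, hd, add_zero] at h0
      obtain rfl := (hi k).1 h0.symm
      refine ⟨fun i => ?_, .inl fun i => ?_⟩
      · rw [hk, hi]; simp
      · rw [hk, hj, eq_sub_iff_add_eq, add_comm]
    · have h0 := hk 0
      rw [Fin.val_zero, pow_zero, Perm.one_apply, hd, sub_zero] at h0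
      obtain rfl := (hi k).1 h0.symm
      refine ⟨fun i => ?_, .inr fun i => ?_⟩
      · rw [hk, hi]; simp
      · rw [hk, hj, neg_sub, sub_eq_iff_eq_add, eq_sub_iff_add_eq, eq_comm, add_comm]

/-- The position is minus the number of steps of `next` to the corner γ of the tile. That number is
well defined modulo 5 because γ occurs once in a tile. -/
theorem exists_isCentred : ∃ pos : D → Fin 5, T.IsCentred pos ∧
    ∀ d, pos d = 0 ↔ T.label d = .γ := by
  obtain ⟨c, -, hex, htile⟩ := h.exists_tile_labels
  choose k hk using hex
  have hk' : ∀ d (i : Fin 5), T.label ((T.next ^ (i : ℕ)) d) = .γ → i = k d := by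
    intro d i hi
    have h5 : T.next ^ 5 = 1 := by ext d; exact h.pentagonal.pow_five d
    have hx : ((i : ℕ) + ((k d - i : Fin 5) : ℕ) = (k d : ℕ)) ∨
        ((i : ℕ) + ((k d - i : Fin 5) : ℕ) = 5 + (k d : ℕ)) := by
      clear hi
      generalize k d = x
      revert x i; decide
    have h1 : (T.next ^ ((k d - i : Fin 5) : ℕ)) ((T.next ^ (i : ℕ)) d) =
        (T.next ^ (k d : ℕ)) d := by
      rw [← Perm.mul_apply, ← pow_add, add_comm]
      rcases hx with hx | hx <;> rw [hx]
      rw [pow_add, h5, one_mul]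
    have := ((htile _ hi).1 (k d - i)).1 (by rw [h1, hk])
    rw [sub_eq_zero] at this
    exact this.symm
  have h0 : ∀ d, -k d = 0 ↔ T.label d = .γ := by
    intro d
    rw [neg_eq_zero]
    constructor
    · intro hd
      have := hk d
      rwa [hd] at this
    · intro hd
      exact (hk' d 0 (by simpa using hd)).symm
  refine ⟨fun d => -k d, ⟨h.pentagonal.pow_five, fun d => ?_, fun d => ?_, fun d hd => ?_⟩, h0⟩
  · have h5 : ∀ i : Fin 5, (T.next ^ ((i - 1 : Fin 5) : ℕ)) (T.next d) = (T.next ^ (i : ℕ)) d := by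
      intro i
      have hp := h.pentagonal.pow_five d
      fin_cases i
      · exact hp
      all_goals rfl
    have := hk' (T.next d) (k d - 1) (by rw [h5, hk])
    rw [← this, neg_sub, sub_eq_neg_add]
  · rw [h0, h0, h.label_rot_eq_γ]
  · rw [Ne, h0] at hd
    have := Function.isPeriodicPt_minimalPeriod T.rot d
    rw [h.minimalPeriod_of_label_ne_γ hd] at this
    exact this

end IsLocalTiling

end LabelledMap

/-! ## Labelled pentagonal subdivisions -/

section PentSub

variable {E : Type*} (P : OrientedMap E)

theorem pentSub_next_apply (d : E) (i : Fin 5) : (pentSub P).next (d, i) = (d, i + 1) := rfl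

theorem pentSub_next_pow (i j : Fin 5) (d : E) :
    ((pentSub P).next ^ (j : ℕ)) (d, i) = (d, i + j) := by
  fin_cases j <;> simp [pow_succ, pentSub_next_apply, add_assoc]

theorem pentSub_next_five (x : E × Fin 5) : ((pentSub P).next ^ 5) x = x := by
  obtain ⟨d, i⟩ := x
  change (d, i + 1 + 1 + 1 + 1 + 1) = (d, i)
  congr 1
  revert i; decide

theorem pentSub_rot_zero (d : E) : (pentSub P).rot (d, 0) = (P.next d, 0) := rfl

theorem pentSub_rot_one (d : E) : (pentSub P).rot (d, 1) = (P.next.symm d, 4) := rfl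

theorem pentSub_rot_two (d : E) : (pentSub P).rot (d, 2) = (P.rot d, 2) := rfl

theorem pentSub_rot_three (d : E) : (pentSub P).rot (d, 3) = (P.rot.symm d, 1) := rfl

/-- The type of the vertex of a corner of the pentagonal subdivision: a centre, a vertex of `P`, or
an inserted point. -/
def pentSubVertexKey : E × Fin 5 → Option (Option E)
  | (_, 0) => none
  | (d, 1) => some (some d)
  | (_, 2) => some none
  | (d, 3) => some (some (P.rot.symm d))
  | (d, 4) => some (some (P.next d))

theorem pentSubVertexKey_rot (x : E × Fin 5) :
    pentSubVertexKey P ((pentSub P).rot x) = pentSubVertexKey P x := by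
  obtain ⟨d, i⟩ := x
  fin_cases i
  · rfl
  · change some (some (P.next (P.next.symm d))) = some (some d)
    rw [Equiv.apply_symm_apply]
  · rfl
  · rfl
  · change some (some (P.next (P.opp.symm (P.opp d)))) = some (some (P.next d))
    rw [Equiv.symm_apply_apply]

theorem pentSubVertexKey_sameCycle {x y : E × Fin 5} (h : (pentSub P).rot.SameCycle x y) :
    pentSubVertexKey P x = pentSubVertexKey P y := by
  obtain ⟨i, rfl⟩ := h
  have hn : ∀ (n : ℕ) x, pentSubVertexKey P (((pentSub P).rot ^ n) x) = pentSubVertexKey P x := by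
    intro n
    induction n with
    | zero => simp
    | succ n ih => intro x; rw [pow_succ', Perm.mul_apply, pentSubVertexKey_rot, ih]
  cases i with
  | ofNat n => exact (hn n x).symm
  | negSucc n =>
    conv_rhs => rw [← hn (n + 1)]
    rw [zpow_negSucc, ← Perm.mul_apply, mul_inv_cancel, Perm.one_apply]

/-- An inserted point is named by the dart of its corner at position 1. Two of the three inserted
points of a tile could share a name only if `next`, `rot` or `opp` fixed a dart. -/
theorem pentSubVertexKey_injective (h1 : ∀ d, P.next d ≠ d) (h2 : ∀ d, P.rot d ≠ d) (d : E)
    {i j : Fin 5} (h : pentSubVertexKey P (d, i) = pentSubVertexKey P (d, j)) : i = j := by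
  have h2' : P.rot.symm d ≠ d := fun h => h2 d ((Equiv.symm_apply_eq _).1 h).symm
  have h3 : P.rot.symm d ≠ P.next d := fun h => by
    rw [Equiv.symm_apply_eq, P.rot_next] at h
    exact P.opp_ne d h.symm
  fin_cases i <;> fin_cases j <;>
    simp [pentSubVertexKey, h1, h2', h3, (h1 _).symm, h2'.symm, h3.symm] at h ⊢

theorem pentSub_pentagonal (h1 : ∀ d, P.next d ≠ d) (h2 : ∀ d, P.rot d ≠ d) :
    (pentSub P).Pentagonal := by
  rintro ⟨d, k⟩
  refine ⟨pentSub_next_five P _, fun i j hij => ?_⟩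
  simp only [pentSub_next_pow, OrientedMap.vertex_eq_iff] at hij
  exact add_left_cancel (pentSubVertexKey_injective P h1 h2 d (pentSubVertexKey_sameCycle P hij))

theorem pentSub_connected_iff : (pentSub P).Connected ↔ P.Connected := by
  constructor
  · intro h
    refine P.connected_iff.2 fun Q h1 h2 x y hx => ?_
    refine (pentSub P).connected_iff.1 h (fun x => Q x.1) (fun x => Iff.rfl) ?_ (x, 0) (y, 0) hx
    have h1' : ∀ d, Q (P.next.symm d) ↔ Q d := fun d => by rw [← h1, Equiv.apply_symm_apply]
    have h3 : ∀ d, Q (P.rot d) ↔ Q d := fun d => by rw [P.rot_apply, h2, h1']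
    have h3' : ∀ d, Q (P.rot.symm d) ↔ Q d := fun d => by rw [← h3, Equiv.apply_symm_apply]
    rintro ⟨d, i⟩
    fin_cases i
    · exact h1' d
    · exact h3 d
    · exact h3' d
    · exact h2 d
    · exact h1 d
  · intro h
    refine (pentSub P).connected_iff.2 fun Q h1 h2 => ?_
    have hs : ∀ d (i : Fin 5), Q (d, i) ↔ Q (d, 0) := by
      intro d i
      fin_cases i
      · rfl
      · exact h1 (d, 0)
      · exact (h1 (d, 1)).trans (h1 (d, 0))
      · exact (h1 (d, 2)).trans ((h1 (d, 1)).trans (h1 (d, 0)))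
      · exact (h1 (d, 4)).symm
    rintro ⟨x, i⟩ ⟨y, j⟩ hx
    rw [hs] at hx ⊢
    refine P.connected_iff.1 h (fun d => Q (d, 0)) (fun d => ?_) (fun d => ?_) x y hx
    · exact (h2 (d, 4)).trans (hs d 4)
    · rw [← hs _ 3, ← hs d 3]
      exact h2 (d, 3)

/-- The tile labels `γ` at the corner `0`, `β` at the corner `c`, and `α` elsewhere. -/
def tileLabels (c i : Fin 5) : Label3 := if i = 0 then .γ else if i = c then .β else .α

theorem tileLabels_neg (c i : Fin 5) : tileLabels c (-i) = tileLabels (-c) i := by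
  revert c i; decide

theorem map_tileLabels {c : Fin 5} (hc : c ≠ 0) :
    (Finset.univ : Finset (Fin 5)).val.map (tileLabels c) = {.α, .α, .α, .β, .γ} := by
  revert c; decide

open Classical in
/-- The pentagonal subdivision of `P` with the tile labels `w`, read backward in the tiles in `s`. -/
noncomputable def flipped {L : Type*} (w : Fin 5 → L) (s : E → Prop) :
    LabelledMap (E × Fin 5) L where
  toOrientedMap := pentSub P
  label x := if s x.1 then w (-x.2) else w x.2

theorem flipped_toOrientedMap {L : Type*} (w : Fin 5 → L) (s : E → Prop) :
    (flipped P w s).toOrientedMap = pentSub P := rfl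

theorem flipped_label_of {L : Type*} (w : Fin 5 → L) {s : E → Prop} {d : E} (h : s d) (i : Fin 5) :
    (flipped P w s).label (d, i) = w (-i) := if_pos h

theorem flipped_label_of_not {L : Type*} (w : Fin 5 → L) {s : E → Prop} {d : E} (h : ¬ s d)
    (i : Fin 5) : (flipped P w s).label (d, i) = w i := if_neg h

/-- Reading a tile backward from its centre moves β from c to -c, so c matters only up to sign. -/
theorem flipped_tileLabels_neg (c : Fin 5) (s : E → Prop) :
    flipped P (tileLabels (-c)) s = flipped P (tileLabels c) (fun d => ¬ s d) := by
  refine congrArg (LabelledMap.mk (pentSub P)) ?_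
  funext ⟨d, i⟩
  by_cases h : s d <;> simp [h, tileLabels_neg]

theorem flipped_congruentTo {L : Type*} (w : Fin 5 → L) (s : E → Prop) :
    (flipped P w s).CongruentTo w := by
  rintro ⟨d, k⟩
  simp only [flipped_toOrientedMap, pentSub_next_pow]
  by_cases h : s d
  · refine ⟨-k, .inr fun i => ?_⟩
    rw [flipped_label_of _ _ h]; congr 1; abel
  · exact ⟨k, .inl fun i => by rw [flipped_label_of_not _ _ h]⟩

theorem flipped_label_zero (c : Fin 5) (s : E → Prop) (d : E) :
    (flipped P (tileLabels c) s).label (d, 0) = .γ := by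
  by_cases h : s d
  · rw [flipped_label_of _ _ h]; rfl
  · rw [flipped_label_of_not _ _ h]; rfl

end PentSub

/-- The faces of the map are `n`-gons, and its vertices have degree `3`. -/
structure OrientedMap.IsTrivalent {E : Type*} (P : OrientedMap E) (n : ℕ) : Prop where
  connected : P.Connected
  next_ne : ∀ d, P.next d ≠ d
  rot_ne : ∀ d, P.rot d ≠ d
  rot_three : ∀ d, P.rot (P.rot (P.rot d)) = d
  minimalPeriod_next : ∀ d, Function.minimalPeriod P.next d = n

theorem LabelledMap.cornersAt_of_rot_three {D L : Type*} [Fintype D] (T : LabelledMap D L) {d : D}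
    (h3 : T.rot (T.rot (T.rot d)) = d) (h1 : T.rot d ≠ d) :
    T.cornersAt (T.vertex d) = {T.label d, T.label (T.rot d), T.label (T.rot (T.rot d))} := by
  rw [T.cornersAt_eq_map_range, minimalPeriod_eq_of_prime _ Nat.prime_three h3 h1]
  simp [Multiset.range_succ, pow_two, Multiset.cons_swap, ← Multiset.cons_zero]

/-! ### Which flips give tilings -/

namespace OrientedMap.IsTrivalent

variable {E : Type*} [Fintype E] {P : OrientedMap E} {n N : ℕ}

/-- Centres have γⁿ for any flips. Every inserted point has one corner at each of the positions 1,
4, 3, so `h1` covers all of them and `h2` the vertices of P. -/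
theorem isLocalTiling_flipped (hP : P.IsTrivalent n) (hN : Nat.card E = N) {c : Fin 5} (hc : c ≠ 0)
    {s : E → Prop}
    (h2 : ∀ d, IsCombination n {(flipped P (tileLabels c) s).label (d, 2),
      (flipped P (tileLabels c) s).label (P.rot d, 2),
      (flipped P (tileLabels c) s).label (P.rot (P.rot d), 2)})
    (h1 : ∀ d, IsCombination n {(flipped P (tileLabels c) s).label (d, 1),
      (flipped P (tileLabels c) s).label (P.next.symm d, 4),
      (flipped P (tileLabels c) s).label (P.rot d, 3)}) :
    (flipped P (tileLabels c) s).IsLocalTiling n N where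
  connected := (pentSub_connected_iff P).2 hP.connected
  pentagonal := pentSub_pentagonal P hP.next_ne hP.rot_ne
  congruent := ⟨tileLabels c, map_tileLabels hc, flipped_congruentTo P _ s⟩
  card := by rw [Nat.card_prod, hN, Nat.card_fin, mul_comm]
  corners := by
    set T := flipped P (tileLabels c) s
    have hrot : ∀ x, T.rot x = (pentSub P).rot x := fun _ => rfl
    have hone : ∀ d, IsCombination n (T.cornersAt (T.vertex (d, 1))) := by
      intro d
      have e2 : T.rot (T.rot (d, 1)) = (P.rot d, 3) := rfl
      rw [T.cornersAt_of_rot_three, e2]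
      · exact h1 d
      · rw [e2, hrot, pentSub_rot_three, Equiv.symm_apply_apply]
      · rw [hrot, pentSub_rot_one]
        intro h
        exact absurd (congrArg Prod.snd h) (show ¬ (4 : Fin 5) = 1 by decide)
    have hv : ∀ x, T.vertex (T.rot x) = T.vertex x := fun x =>
      T.vertex_eq_iff.2 (Perm.SameCycle.symm ⟨1, by simp⟩)
    rintro ⟨d, i⟩
    fin_cases i
    · right; right
      change T.cornersAt (T.vertex (d, 0)) = _
      have hpow : ∀ (i : ℕ), (T.rot ^ i) (d, 0) = ((P.next ^ i) d, 0) := by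
        intro i
        induction i with
        | zero => rfl
        | succ i ih =>
          rw [pow_succ', Perm.mul_apply, ih, hrot, pentSub_rot_zero, pow_succ', Perm.mul_apply]
      have hm : Function.minimalPeriod T.rot (d, 0) = n := by
        rw [← hP.minimalPeriod_next d, Function.minimalPeriod_eq_minimalPeriod_iff]
        intro i
        simp [Function.IsPeriodicPt, Function.IsFixedPt, Perm.iterate_eq_pow, hpow]
      rw [T.cornersAt_eq_map_range, hm]
      simp only [hpow, T, flipped_label_zero]
      simp
    · exact hone d
    · change IsCombination n (T.cornersAt (T.vertex (d, 2)))
      rw [T.cornersAt_of_rot_three]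
      · exact h2 d
      · simp only [hrot, pentSub_rot_two, hP.rot_three]
      · rw [hrot, pentSub_rot_two]
        exact fun h => hP.rot_ne d (congrArg Prod.fst h)
    · change IsCombination n (T.cornersAt (T.vertex (d, 3)))
      rw [← hv]
      exact hone _
    · change IsCombination n (T.cornersAt (T.vertex (d, 4)))
      rw [← hv, ← hv]
      exact hone _

/-- Here β is at position 1, or at 4 after a flip. Consecutive tiles around a face meet with their
corners 4 and 1 at an inserted point, so a flipped tile followed by an unflipped one would put two β
there. The reverse implication uses that `next` permutes a finite set. -/
theorem isLocalTiling_flipped_one_iff (hP : P.IsTrivalent n) (hN : Nat.card E = N)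
    {s : E → Prop} :
    (flipped P (tileLabels 1) s).IsLocalTiling n N ↔ ∀ d, s (P.next d) ↔ s d := by
  constructor
  · intro h
    have hd : ∀ d, s d → s (P.next d) := by
      intro d hs
      by_contra hs'
      have := h.eq_of_label_eq_β (d := (P.next d, 1)) (e := (d, 4)) ⟨1, by
          rw [zpow_one, flipped_toOrientedMap, pentSub_rot_one, Equiv.symm_apply_apply]⟩
        (by rw [flipped_label_of_not _ _ hs']; rfl) (by rw [flipped_label_of _ _ hs]; rfl)
      exact absurd (congrArg Prod.snd this) (show ¬ (1 : Fin 5) = 4 by decide)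
    intro d
    refine ⟨fun hs => ?_, hd d⟩
    have := Perm.perm_symm_on_of_perm_on_finite (f := P.next) (p := s) hd hs
    rwa [Equiv.symm_apply_apply] at this
  · intro h
    refine hP.isLocalTiling_flipped hN (by decide) (fun d => .inr (.inl ?_)) fun d => .inl ?_
    · have : ∀ d, (flipped P (tileLabels 1) s).label (d, 2) = .α := fun d => by
        by_cases hs : s d
        · rw [flipped_label_of _ _ hs]; rfl
        · rw [flipped_label_of_not _ _ hs]; rfl
      simp only [this]
    · have h3 : ∀ d, (flipped P (tileLabels 1) s).label (d, 3) = .α := fun d => by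
        by_cases hs : s d
        · rw [flipped_label_of _ _ hs]; rfl
        · rw [flipped_label_of_not _ _ hs]; rfl
      obtain ⟨d, rfl⟩ := P.next.surjective d
      rw [Equiv.symm_apply_apply, h3]
      by_cases hs : s d
      · rw [flipped_label_of _ _ hs, flipped_label_of _ _ ((h d).2 hs)]; decide
      · rw [flipped_label_of_not _ _ hs, flipped_label_of_not _ _ (fun h' => hs ((h d).1 h'))]
        decide

/-- Here β is at position 3, or at 2 after a flip. An inserted point has a single corner at position
3, hence at most one β; the only constraint is at the vertices of P, where the corners at position 2
meet. -/
theorem isLocalTiling_flipped_three_iff (hP : P.IsTrivalent n) (hN : Nat.card E = N)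
    {s : E → Prop} :
    (flipped P (tileLabels 3) s).IsLocalTiling n N ↔
      ∀ d e, P.vertex d = P.vertex e → s d → s e → d = e := by
  constructor
  · intro h d e hde hd he
    have hcyc : (flipped P (tileLabels 3) s).rot.SameCycle (d, 2) (e, 2) := by
      obtain ⟨i, rfl⟩ := (P.vertex_eq_iff.1 hde).exists_nat_pow_eq
      refine ⟨i, ?_⟩
      rw [zpow_natCast]
      clear hde he
      induction i with
      | zero => rfl
      | succ i ih =>
        rw [pow_succ', Perm.mul_apply, ih, flipped_toOrientedMap, pentSub_rot_two, pow_succ',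
          Perm.mul_apply]
    have := h.eq_of_label_eq_β hcyc (by rw [flipped_label_of _ _ hd]; rfl)
      (by rw [flipped_label_of _ _ he]; rfl)
    exact congrArg Prod.fst this
  · intro h
    refine hP.isLocalTiling_flipped hN (by decide) (fun d => ?_) fun d => ?_
    · have hv : ∀ d, P.vertex (P.rot d) = P.vertex d := fun d =>
        P.vertex_eq_iff.2 (Perm.SameCycle.symm ⟨1, by simp⟩)
      have hl : ∀ d, (s d ∧ (flipped P (tileLabels 3) s).label (d, 2) = .β) ∨
          (¬ s d ∧ (flipped P (tileLabels 3) s).label (d, 2) = .α) := by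
        intro d
        by_cases hs : s d
        · exact .inl ⟨hs, by rw [flipped_label_of _ _ hs]; rfl⟩
        · exact .inr ⟨hs, by rw [flipped_label_of_not _ _ hs]; rfl⟩
      have n1 : ∀ d, s d → ¬ s (P.rot d) := fun d h1 h2 =>
        hP.rot_ne d (h d _ (hv d).symm h1 h2).symm
      have n2 := n1 d
      have n3 := n1 (P.rot d)
      have n4 := n1 (P.rot (P.rot d))
      rw [hP.rot_three] at n4
      obtain ⟨a1, a2⟩ | ⟨a1, a2⟩ := hl d <;>
      obtain ⟨b1, b2⟩ | ⟨b1, b2⟩ := hl (P.rot d) <;>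
      obtain ⟨c1, c2⟩ | ⟨c1, c2⟩ := hl (P.rot (P.rot d)) <;>
      first
        | exact absurd b1 (n2 a1)
        | exact absurd c1 (n3 b1)
        | exact absurd a1 (n4 c1)
        | (rw [a2, b2, c2]; exact .inl (by decide))
        | (rw [a2, b2, c2]; exact .inr (.inl (by decide)))
    · have hα : ∀ d, (flipped P (tileLabels 3) s).label (d, 1) = .α ∧
          (flipped P (tileLabels 3) s).label (d, 4) = .α := fun d => by
        by_cases hs : s d
        · rw [flipped_label_of _ _ hs, flipped_label_of _ _ hs]; decide
        · rw [flipped_label_of_not _ _ hs, flipped_label_of_not _ _ hs]; decide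
      rw [(hα _).1, (hα _).2]
      by_cases hs : s (P.rot d)
      · rw [flipped_label_of _ _ hs]; exact .inr (.inl rfl)
      · rw [flipped_label_of_not _ _ hs]; exact .inl rfl

end OrientedMap.IsTrivalent

-- Reduction to flipped subdivisions of one map

universe u

/-- Up to isomorphism, `P` is determined by its number of darts and by the relations between
its permutations, which hold in every map with `n`-gonal faces and vertices of degree `3`. -/
def OrientedMap.IsDetermined {E : Type*} (P : OrientedMap E) (n : ℕ) : Prop :=
  ∀ (E' : Type u) [Finite E'] (P' : OrientedMap E'), P'.next ^ n = 1 → P'.rot ^ 3 = 1 →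
    P'.Connected → Nat.card E' = Nat.card E →
    ∃ f : E ≃ E', (∀ d, f (P.next d) = P'.next (f d)) ∧ ∀ d, f (P.opp d) = P'.opp (f d)

/-- The pentagonal subdivisions of isomorphic maps are isomorphic. -/
theorem pentSub_iso {E E' : Type*} {P : OrientedMap E} {P' : OrientedMap E'} (f : E ≃ E')
    (h1 : ∀ d, f (P.next d) = P'.next (f d)) (h2 : ∀ d, f (P.opp d) = P'.opp (f d))
    (x : E × Fin 5) :
    f.prodCongr (Equiv.refl _) ((pentSub P).opp x) =
      (pentSub P').opp (f.prodCongr (Equiv.refl _) x) := by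
  have h1' : ∀ d, f (P.next.symm d) = P'.next.symm (f d) := fun d => by
    rw [Equiv.eq_symm_apply, ← h1, Equiv.apply_symm_apply]
  have h3 : ∀ d, f (P.rot d) = P'.rot (f d) := fun d => by
    rw [P.rot_apply, P'.rot_apply, h2, h1']
  have h3' : ∀ d, f (P.rot.symm d) = P'.rot.symm (f d) := fun d => by
    rw [Equiv.eq_symm_apply, ← h3, Equiv.apply_symm_apply]
  obtain ⟨d, i⟩ := x
  fin_cases i
  · exact congrArg (·, (4 : Fin 5)) (h1' d)
  · exact congrArg (·, (2 : Fin 5)) (h3 d)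
  · exact congrArg (·, (1 : Fin 5)) (h3' d)
  · exact congrArg (·, (3 : Fin 5)) (h2 d)
  · exact congrArg (·, (0 : Fin 5)) (h1 d)

theorem eq_tileLabels {l : Label3} {c i : Fin 5} (h0 : l = .γ ↔ i = 0) (hc : l = .β ↔ i = c) :
    l = tileLabels c i := by
  unfold tileLabels
  rw [← if_congr h0 rfl rfl, ← if_congr hc rfl rfl]
  cases l <;> rfl

namespace LabelledMap

/-- All the tilings, up to the choice of the tiles to be flipped. -/
theorem IsLocalTiling.exists_same_flipped {E : Type*} {P : OrientedMap E} {n N : ℕ}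
    (hu : OrientedMap.IsDetermined.{u} P n) (hN : Nat.card E = N) {D : Type u} [Fintype D]
    {T : LabelledMap D Label3} (h : T.IsLocalTiling n N) :
    ∃ c : Fin 5, c ≠ 0 ∧ ∃ s, Same T (flipped P (tileLabels c) s) := by
  -- the case of a subdivision, not of its mirror image
  have key : ∀ T : LabelledMap D Label3, T.IsLocalTiling n N → ∀ pos : D → Fin 5,
      T.IsCentred pos → (∀ d, pos d = 0 ↔ T.label d = .γ) →
      (∀ d, pos d = 1 → pos (T.opp d) = 2) →
      ∃ c : Fin 5, c ≠ 0 ∧ ∃ s, DirectIso T (flipped P (tileLabels c) s) := by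
    intro T h pos hpos hγ hA
    obtain ⟨P', f, f1, f2, f3, f5, f6⟩ := hpos.exists_pentSub hA
    have hcard : Nat.card {d // pos d = 0} = Nat.card E := by
      have := Nat.card_congr f
      rw [Nat.card_prod, Nat.card_fin, h.card, mul_comm] at this
      rw [hN]
      exact Nat.eq_of_mul_eq_mul_left (by norm_num) this
    have hnext : P'.next ^ n = 1 := by
      ext g
      have hi : ∀ i : ℕ, ((P'.next ^ i) g : D) = (T.rot ^ i) (g : D) := by
        intro i
        induction i with
        | zero => rfl
        | succ i ih => rw [pow_succ', Perm.mul_apply, f5, ih, pow_succ', Perm.mul_apply]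
      rw [hi, ← h.minimalPeriod_of_label_eq_γ ((hγ _).1 g.2)]
      exact Function.isPeriodicPt_minimalPeriod T.rot (g : D)
    have hconn : P'.Connected := by
      rw [← pentSub_connected_iff]
      refine (pentSub P').connected_iff.2 fun Q q1 q2 x y hx => ?_
      have := T.connected_iff.1 h.connected (fun d => Q (f.symm d))
        (fun d => by
          obtain ⟨z, rfl⟩ := f.surjective d
          rw [← f1, Equiv.symm_apply_apply, Equiv.symm_apply_apply, q1])
        (fun d => by
          obtain ⟨z, rfl⟩ := f.surjective d
          rw [← f2, Equiv.symm_apply_apply, Equiv.symm_apply_apply, q2])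
        (f x) (f y) (by simpa using hx)
      simpa using this
    obtain ⟨e, e1, e2⟩ := hu _ P' hnext f6 hconn hcard
    obtain ⟨c, hc, -, htile⟩ := h.exists_tile_labels
    let F : E × Fin 5 ≃ D := (e.prodCongr (Equiv.refl _)).trans f
    have hFn : ∀ x, F ((pentSub P).next x) = T.next (F x) := fun x =>
      f1 (e.prodCongr (Equiv.refl _) x)
    have hFo : ∀ x, F ((pentSub P).opp x) = T.opp (F x) := fun x => by
      change f (e.prodCongr (Equiv.refl _) ((pentSub P).opp x)) = _
      rw [pentSub_iso e e1 e2, f2]; rfl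
    have hFpow : ∀ d (i : Fin 5), F (d, i) = (T.next ^ (i : ℕ)) (F (d, 0)) := by
      intro d i
      have hj : ∀ (j : ℕ) x, F (((pentSub P).next ^ j) x) = (T.next ^ j) (F x) := by
        intro j
        induction j with
        | zero => simp
        | succ j ih => intro x; rw [pow_succ', Perm.mul_apply, hFn, ih, pow_succ', Perm.mul_apply]
      rw [← hj, pentSub_next_pow, zero_add]
    have hF0 : ∀ d, T.label (F (d, 0)) = .γ := fun d => by
      rw [← hγ]
      exact f3 (e d, 0)
    obtain ⟨s, hs⟩ : ∃ s : E → Prop, ∀ d, ¬ s d ↔ ∀ i : Fin 5, T.label (F (d, i)) = .β ↔ i = c :=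
      ⟨fun d => ¬ ∀ i : Fin 5, T.label (F (d, i)) = .β ↔ i = c, fun d => not_not⟩
    refine ⟨c, hc, s, DirectIso.symm ⟨F, hFn, hFo, ?_⟩⟩
    rintro ⟨d, i⟩
    have ht := htile _ (hF0 d)
    simp only [← hFpow] at ht
    by_cases hd : s d
    · rw [flipped_label_of _ _ hd, tileLabels_neg]
      exact eq_tileLabels (ht.1 i) (ht.2.resolve_left (fun h' => (hs d).2 h' hd) i)
    · rw [flipped_label_of_not _ _ hd]
      exact eq_tileLabels (ht.1 i) ((hs d).1 hd i)
  obtain ⟨pos, hpos, hγ⟩ := h.exists_isCentred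
  rcases hpos.pos_opp_one_dichotomy h.connected with hA | hB
  · obtain ⟨c, hc, s, hs⟩ := key T h pos hpos hγ hA
    exact ⟨c, hc, s, .inl hs⟩
  -- The second gluing becomes the first in the mirror image, where positions are negated.
  · obtain ⟨c, hc, s, hs⟩ := key T.mirror h.mirror (fun d => -pos d) (isCentred_mirror hpos)
      (fun d => by rw [neg_eq_zero]; exact hγ d) (hpos.pos_opp_mirror hB)
    refine ⟨c, hc, s, .inr ?_⟩
    have := hs.mirror
    rwa [mirror_mirror] at this

end LabelledMap

open LabelledMap

theorem adjacentInTile_flipped_one {E : Type*} [Nonempty E] (P : OrientedMap E) (s : E → Prop) :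
    (flipped P (tileLabels 1) s).AdjacentInTile .β .γ := by
  obtain ⟨d⟩ := ‹Nonempty E›
  by_cases hs : s d
  · refine ⟨(d, 4), .inl ⟨?_, ?_⟩⟩
    · rw [flipped_label_of _ _ hs]; rfl
    · exact flipped_label_zero P 1 s d
  · refine ⟨(d, 0), .inr ⟨flipped_label_zero P 1 s d, ?_⟩⟩
    change (flipped P (tileLabels 1) s).label (d, 1) = _
    rw [flipped_label_of_not _ _ hs]; rfl

theorem not_adjacentInTile_flipped_three {E : Type*} (P : OrientedMap E) (s : E → Prop) :
    ¬ (flipped P (tileLabels 3) s).AdjacentInTile .β .γ := by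
  rintro ⟨⟨d, i⟩, h⟩
  rw [flipped_toOrientedMap, pentSub_next_apply] at h
  by_cases hs : s d
  · simp only [flipped_label_of _ _ hs] at h
    revert i; decide
  · simp only [flipped_label_of_not _ _ hs] at h
    revert i; decide

/-! ### Flips as reorientations and configurations -/

section Classification

variable {E : Type*} {P : OrientedMap E} {n N : ℕ}

theorem OrientedMap.IsDetermined.exists_same_one_or_three
    (hu : OrientedMap.IsDetermined.{u} P n) (hN : Nat.card E = N) {D : Type u} [Fintype D]
    {T : LabelledMap D Label3} (h : T.IsLocalTiling n N) :
    (∃ s, Same T (flipped P (tileLabels 1) s)) ∨ ∃ s, Same T (flipped P (tileLabels 3) s) := by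
  obtain ⟨c, hc, s, hs⟩ := h.exists_same_flipped hu hN
  fin_cases c
  · exact absurd rfl hc
  · exact .inl ⟨s, hs⟩
  · exact .inr ⟨fun d => ¬ s d, by rw [← flipped_tileLabels_neg]; exact hs⟩
  · exact .inr ⟨s, hs⟩
  · exact .inl ⟨fun d => ¬ s d, by rw [← flipped_tileLabels_neg]; exact hs⟩

theorem reorient_red3B1 (S : Set P.Face) :
    reorient P red3B1 S = flipped P (tileLabels 1) (fun d => P.face d ∈ S) := by
  have h : ∀ i, red3B1 (label5 i) = tileLabels 1 i := by decide
  unfold reorient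
  simp only [h]
  rfl

theorem reorient_red3B3 (S : Set P.Face) :
    reorient P red3B3 S = flipped P (tileLabels 1) (fun d => P.face d ∈ Sᶜ) := by
  have h : ∀ i, red3B3 (label5 i) = tileLabels (-1) i := by decide
  unfold reorient
  simp only [h]
  exact flipped_tileLabels_neg P 1 (fun d => P.face d ∈ S)

theorem configure_red3B2 (c : ∀ v : P.Vertex, Configuration P v) :
    configure P red3B2 c =
      flipped P (tileLabels 3) (fun d => c (P.vertex d) = some ⟨d, rfl⟩) := by
  have h : ∀ i, red3B2 (label5 i) = tileLabels 3 i := by decide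
  -- Negation also exchanges positions 1 and 4, but both carry α.
  have h' : ∀ i, tileLabels 3 (Equiv.swap 2 3 i) = tileLabels 3 (-i) := by decide
  refine congrArg (LabelledMap.mk (pentSub P)) (funext fun x => ?_)
  by_cases hx : c (P.vertex x.1) = some ⟨x.1, rfl⟩ <;> simp [hx, h, h']

theorem exists_face_set_iff {s : E → Prop} (hs : ∀ d, s (P.next d) ↔ s d) :
    ∃ S : Set P.Face, s = fun d => P.face d ∈ S := by
  refine ⟨{F | ∃ d, P.face d = F ∧ s d}, funext fun d => propext ⟨fun h => ⟨d, rfl, h⟩, ?_⟩⟩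
  rintro ⟨e, he, hse⟩
  have := (P.face_eq_iff.1 he)
  obtain ⟨i, rfl⟩ := this
  have hn : ∀ (n : ℕ) x, s ((P.next ^ n) x) ↔ s x := by
    intro n
    induction n with
    | zero => simp
    | succ n ih => intro x; rw [pow_succ', Perm.mul_apply, hs, ih]
  cases i with
  | ofNat n => exact (hn n e).2 hse
  | negSucc n =>
    rw [← hn (n + 1), zpow_negSucc, ← Perm.mul_apply, mul_inv_cancel, Perm.one_apply]
    exact hse

theorem face_set_next (S : Set P.Face) (d : E) : P.face (P.next d) ∈ S ↔ P.face d ∈ S := by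
  rw [P.face_eq_iff.2 (⟨-1, by simp⟩ : P.next.SameCycle (P.next d) d)]

theorem exists_configuration {s : E → Prop}
    (hs : ∀ d e, P.vertex d = P.vertex e → s d → s e → d = e) :
    ∃ c : ∀ v : P.Vertex, Configuration P v,
      s = fun d => c (P.vertex d) = some ⟨d, rfl⟩ := by
  classical
  refine ⟨fun v => if h : ∃ d : {d // P.vertex d = v}, s d then some h.choose else none,
    funext fun d => propext ?_⟩
  constructor
  · intro hd
    have h : ∃ e : {e // P.vertex e = P.vertex d}, s e := ⟨⟨d, rfl⟩, hd⟩
    refine (dif_pos h).trans ?_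
    exact congrArg some (Subtype.ext (hs _ _ h.choose.2 h.choose_spec hd))
  · intro hd
    by_cases h : ∃ e : {e // P.vertex e = P.vertex d}, s e
    · replace hd := (dif_pos h).symm.trans hd
      have := h.choose_spec
      rwa [Option.some.inj hd] at this
    · replace hd := (dif_neg h).symm.trans hd
      exact absurd hd (by simp)

theorem configuration_unique (c : ∀ v : P.Vertex, Configuration P v) (d e : E)
    (hde : P.vertex d = P.vertex e) (hd : c (P.vertex d) = some ⟨d, rfl⟩)
    (he : c (P.vertex e) = some ⟨e, rfl⟩) : d = e := by
  have key : ∀ v (hv : P.vertex d = v), c v = some ⟨d, hv⟩ := by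
    rintro _ rfl
    exact hd
  have := (key _ hde).symm.trans he
  exact congrArg Subtype.val (Option.some.inj this)

variable [Fintype E]

/-- The tilings with adjacent `β`, `γ`. -/
theorem OrientedMap.IsTrivalent.adjacent_iff [Nonempty E] (hP : P.IsTrivalent n)
    (hu : OrientedMap.IsDetermined.{u} P n) (hN : Nat.card E = N) {D : Type u} [Fintype D]
    (T : LabelledMap D Label3) :
    (T.IsLocalTiling n N ∧ T.AdjacentInTile .β .γ) ↔
      ∃ s, (∀ d, s (P.next d) ↔ s d) ∧ Same T (flipped P (tileLabels 1) s) := by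
  constructor
  · rintro ⟨h, ha⟩
    rcases hu.exists_same_one_or_three hN h with ⟨s, hs⟩ | ⟨s, hs⟩
    · exact ⟨s, (hP.isLocalTiling_flipped_one_iff hN).1 (hs.symm.isLocalTiling h), hs⟩
    · exact absurd (hs.adjacentInTile_iff.1 ha) (not_adjacentInTile_flipped_three P s)
  · rintro ⟨s, hs, h⟩
    exact ⟨h.isLocalTiling ((hP.isLocalTiling_flipped_one_iff hN).2 hs),
      h.adjacentInTile_iff.2 (adjacentInTile_flipped_one P s)⟩

/-- The tilings with nonadjacent `β`, `γ`. -/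
theorem OrientedMap.IsTrivalent.not_adjacent_iff [Nonempty E] (hP : P.IsTrivalent n)
    (hu : OrientedMap.IsDetermined.{u} P n) (hN : Nat.card E = N) {D : Type u} [Fintype D]
    (T : LabelledMap D Label3) :
    (T.IsLocalTiling n N ∧ ¬ T.AdjacentInTile .β .γ) ↔
      ∃ s : E → Prop, (∀ d e, P.vertex d = P.vertex e → s d → s e → d = e) ∧
        Same T (flipped P (tileLabels 3) s) := by
  constructor
  · rintro ⟨h, ha⟩
    rcases hu.exists_same_one_or_three hN h with ⟨s, hs⟩ | ⟨s, hs⟩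
    · exact absurd (hs.adjacentInTile_iff.2 (adjacentInTile_flipped_one P s)) ha
    · exact ⟨s, (hP.isLocalTiling_flipped_three_iff hN).1 (hs.symm.isLocalTiling h), hs⟩
  · rintro ⟨s, hs, h⟩
    exact ⟨h.isLocalTiling ((hP.isLocalTiling_flipped_three_iff hN).2 hs),
      fun ha => not_adjacentInTile_flipped_three P s (h.adjacentInTile_iff.1 ha)⟩

/-- The classification of the tilings. -/
theorem OrientedMap.IsTrivalent.classification [Nonempty E] (hP : P.IsTrivalent n)
    (hu : OrientedMap.IsDetermined.{u} P n) (hN : Nat.card E = N) (D : Type u) [Fintype D]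
    (T : LabelledMap D Label3) :
    (∀ r ∈ ({red3B1, red3B3} : Set (Label5 → Label3)),
      (T.IsLocalTiling n N ∧ T.AdjacentInTile .β .γ) ↔
        ∃ S : Set P.Face, T.Same (reorient P r S)) ∧
    ((T.IsLocalTiling n N ∧ ¬ T.AdjacentInTile .β .γ) ↔
      ∃ c : ∀ v : P.Vertex, Configuration P v, T.Same (configure P red3B2 c)) := by
  refine ⟨?_, ?_⟩
  · have h1 : (T.IsLocalTiling n N ∧ T.AdjacentInTile .β .γ) ↔
        ∃ S : Set P.Face, T.Same (reorient P red3B1 S) := by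
      rw [hP.adjacent_iff hu hN]
      constructor
      · rintro ⟨s, hs, h⟩
        obtain ⟨S, rfl⟩ := exists_face_set_iff hs
        exact ⟨S, by rwa [reorient_red3B1]⟩
      · rintro ⟨S, h⟩
        rw [reorient_red3B1] at h
        exact ⟨_, face_set_next S, h⟩
    rintro r (rfl | rfl)
    · exact h1
    · rw [h1]
      constructor
      · rintro ⟨S, h⟩
        -- The two reductions differ by reversing every face, hence the complement.
        exact ⟨Sᶜ, by rwa [reorient_red3B3, compl_compl, ← reorient_red3B1]⟩
      · rintro ⟨S, h⟩
        exact ⟨Sᶜ, by rwa [reorient_red3B1, ← reorient_red3B3]⟩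
  · rw [hP.not_adjacent_iff hu hN]
    constructor
    · rintro ⟨s, hs, h⟩
      obtain ⟨c, rfl⟩ := exists_configuration hs
      exact ⟨c, by rwa [configure_red3B2]⟩
    · rintro ⟨c, h⟩
      rw [configure_red3B2] at h
      exact ⟨_, configuration_unique c, h⟩

theorem OrientedMap.IsTrivalent.isLocalTiling_reduction (hP : P.IsTrivalent n)
    (hN : Nat.card E = N) (r : Label5 → Label3)
    (hr : r ∈ ({red3B1, red3B2, red3B3} : Set (Label5 → Label3))) :
    (reduction P r).IsLocalTiling n N := by
  have h0 : ∀ r, reduction P r = reorient P r ∅ := fun r => by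
    unfold reduction reorient
    simp
  rcases hr with rfl | rfl | rfl
  · rw [h0, reorient_red3B1, hP.isLocalTiling_flipped_one_iff hN]
    exact face_set_next _
  · have h : reduction P red3B2 = configure P red3B2 (fun _ => none) := by
      unfold reduction configure
      simp
    rw [h, configure_red3B2, hP.isLocalTiling_flipped_three_iff hN]
    exact configuration_unique fun _ => none
  · rw [h0, reorient_red3B3, hP.isLocalTiling_flipped_one_iff hN]
    exact face_set_next _

end Classification

/-! ## The cube and the dodecahedron -/

/-- `P` is determined, if its permutations are given by left multiplication with `r`, `t` on a family of
elements of each group with elements `r`, `t` that satisfy the relations. -/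
theorem OrientedMap.isDetermined_of_words {E : Type*} [Finite E] [Nonempty E] {P : OrientedMap E}
    {n : ℕ} (h : ∀ (G : Type u) [Group G] (r t : G), t * t = 1 → r ^ n = 1 → (t * r⁻¹) ^ 3 = 1 →
      ∃ g : E → G, (∀ d, g (P.next d) = r * g d) ∧ ∀ d, g (P.opp d) = t * g d) :
    OrientedMap.IsDetermined.{u} P n := by
  intro E' _ P' hr hrot hconn hcard
  obtain ⟨g, g1, g2⟩ := h (Perm E') P'.next P'.opp (by ext d; simp [P'.opp_opp]) hr hrot
  have hne : Nonempty E' := by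
    rw [← Finite.card_pos_iff, hcard, Finite.card_pos_iff]; infer_instance
  obtain ⟨x⟩ := hne
  have f1 : ∀ d, g (P.next d) x = P'.next (g d x) := fun d => by rw [g1]; rfl
  have f2 : ∀ d, g (P.opp d) x = P'.opp (g d x) := fun d => by rw [g2]; rfl
  -- The image of the orbit map is closed under both permutations and their inverses, so
  -- connectedness makes it everything; equal cardinalities then give bijectivity.
  have hsurj : Function.Surjective fun d => g d x := by
    obtain ⟨d₀⟩ := ‹Nonempty E›
    intro y
    refine P'.connected_iff.1 hconn (fun y => ∃ d, g d x = y) (fun y => ⟨?_, ?_⟩)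
      (fun y => ⟨?_, ?_⟩) (g d₀ x) y ⟨d₀, rfl⟩
    · rintro ⟨d, hd⟩
      refine ⟨P.next.symm d, P'.next.injective ?_⟩
      rw [← f1, Equiv.apply_symm_apply, hd]
    · rintro ⟨d, rfl⟩
      exact ⟨P.next d, f1 d⟩
    · rintro ⟨d, hd⟩
      refine ⟨P.opp d, P'.opp.injective ?_⟩
      rw [← f2, P.opp_opp, hd]
    · rintro ⟨d, rfl⟩
      exact ⟨P.opp d, f2 d⟩
  exact ⟨Equiv.ofBijective _ ((Nat.bijective_iff_surjective_and_card _).2 ⟨hsurj, hcard.symm⟩),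
    f1, f2⟩

/-! ### Word identities in the groups of the cube and the dodecahedron -/

section Relations

variable {G : Type*} [Group G] {r t : G}

/-- The braid-like form of the relation of degree 3; it and its inverse are the rewriting rules for
all the words below. -/
theorem mul_inv_mul_of_pow_three (ht : t * t = 1) (h : (t * r⁻¹) ^ 3 = 1) :
    r * t * r = t * r⁻¹ * t := by
  have ht' : t⁻¹ = t := inv_eq_of_mul_eq_one_left ht
  have h1 : t * r⁻¹ * t * (r⁻¹ * t * r⁻¹) = 1 := by
    rw [← h]; simp [pow_succ, mul_assoc]
  rw [eq_inv_of_mul_eq_one_left h1]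
  simp [ht', mul_assoc]

theorem mul_mul_of_pow_three (ht : t * t = 1) (h : (t * r⁻¹) ^ 3 = 1) :
    t * r * t = r⁻¹ * t * r⁻¹ := by
  have ht' : t⁻¹ = t := inv_eq_of_mul_eq_one_left ht
  have := congrArg (·⁻¹) (mul_inv_mul_of_pow_three ht h)
  simpa [ht', mul_assoc] using this.symm

theorem pow_fin_add_one {n : ℕ} [NeZero n] (hr : r ^ n = 1) (i : Fin n) :
    r ^ ((i + 1 : Fin n) : ℕ) = r * r ^ (i : ℕ) := by
  rw [← pow_succ', Fin.val_add, Fin.val_one', Nat.add_mod_mod, ← pow_eq_pow_mod _ hr]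

theorem pow_fin_neg {n : ℕ} [NeZero n] (hr : r ^ n = 1) (i : Fin n) :
    r ^ ((-i : Fin n) : ℕ) = r⁻¹ ^ (i : ℕ) := by
  rw [inv_pow, eq_inv_iff_mul_eq_one, ← pow_add, pow_eq_pow_mod _ hr, ← Fin.val_add,
    neg_add_cancel]
  exact pow_zero r

/-- Meant for the bottom face, whose sides are numbered against the ring of faces around it. -/
theorem pow_neg_mul_of_conj {n : ℕ} [NeZero n] (hr : r ^ n = 1) {x : G} (hx : r * x * r = x)
    (i : Fin n) : r ^ ((-i : Fin n) : ℕ) * x = x * r ^ (i : ℕ) := by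
  rw [pow_fin_neg hr]
  have h1 : SemiconjBy x r r⁻¹ := by
    rw [SemiconjBy, eq_inv_mul_iff_mul_eq, ← mul_assoc, hx]
  exact (h1.pow_right i).symm

end Relations

instance : Nonempty CubeFace := ⟨.top⟩

instance : Nonempty DodecahedronFace := ⟨.top⟩

/-- The faces of the cube, reached from the top face. -/
def cubeWord {G : Type*} [Group G] (r t : G) : CubeFace → G
  | .top => 1
  | .side i => t * r ^ (i : ℕ)
  | .bottom => t * r ^ 2 * t

theorem cube_isDetermined : OrientedMap.IsDetermined.{u} cube 4 := by
  refine OrientedMap.isDetermined_of_words fun G _ r t ht hr h3 => ?_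
  have e1 := mul_inv_mul_of_pow_three ht h3
  have htt : ∀ x, t * (t * x) = x := fun x => by rw [← mul_assoc, ht, one_mul]
  refine ⟨fun d => r ^ (d.2 : ℕ) * cubeWord r t d.1, ?_, ?_⟩
  · rintro ⟨F, j⟩
    change r ^ ((j + 1 : Fin 4) : ℕ) * cubeWord r t F = _
    rw [pow_fin_add_one hr, mul_assoc]
  -- Since `t` is an involution, each edge needs checking from only one of its two darts.
  · have hinv : ∀ d e, cubeOpp d = e →
        r ^ (e.2 : ℕ) * cubeWord r t e.1 = t * (r ^ (d.2 : ℕ) * cubeWord r t d.1) →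
        r ^ ((cubeOpp e).2 : ℕ) * cubeWord r t (cubeOpp e).1 =
          t * (r ^ (e.2 : ℕ) * cubeWord r t e.1) := by
      rintro d _ rfl hd
      rw [hd, htt, cubeOpp_involutive]
    have top : ∀ i, r ^ ((0 : Fin 4) : ℕ) * cubeWord r t (.side i) =
        t * (r ^ (i : ℕ) * cubeWord r t .top) := fun i => by simp [cubeWord]
    have side : ∀ i, r ^ ((1 : Fin 4) : ℕ) * cubeWord r t (.side (i + 1)) =
        t * (r ^ ((3 : Fin 4) : ℕ) * cubeWord r t (.side i)) := fun i => by
      have hr3 : r ^ 3 = r⁻¹ := eq_inv_of_mul_eq_one_left (by rw [← pow_succ, hr])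
      change r ^ 1 * (t * r ^ ((i + 1 : Fin 4) : ℕ)) = t * (r ^ 3 * (t * r ^ (i : ℕ)))
      rw [pow_fin_add_one hr, hr3, pow_one]
      simp only [← mul_assoc]
      rw [e1]
    have bottom : ∀ i, r ^ ((-i : Fin 4) : ℕ) * cubeWord r t .bottom =
        t * (r ^ ((2 : Fin 4) : ℕ) * cubeWord r t (.side i)) := fun i => by
      change r ^ ((-i : Fin 4) : ℕ) * (t * r ^ 2 * t) = t * (r ^ 2 * (t * r ^ (i : ℕ)))
      rw [pow_neg_mul_of_conj hr]
      · simp only [mul_assoc]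
      · have hr2 : r⁻¹ * r⁻¹ = r ^ 2 := by
          rw [← mul_inv_rev, inv_eq_iff_mul_eq_one, ← pow_two, ← pow_add, hr]
        calc r * (t * r ^ 2 * t) * r = (r * t * r) * (r * t * r) := by
              simp only [pow_two, mul_assoc]
          _ = t * (r⁻¹ * r⁻¹) * t := by
              rw [e1]; simp only [mul_assoc, htt]
          _ = _ := by rw [hr2]
    rintro ⟨F | i | F, j⟩
    · exact top j
    · fin_cases j
      · exact hinv (.top, i) _ rfl (top i)
      · obtain ⟨i, rfl⟩ : ∃ k, i = k + 1 := ⟨i - 1, (sub_add_cancel _ _).symm⟩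
        exact hinv (.side i, 3) (_, _) rfl (side i)
      · exact bottom i
      · exact side i
    · obtain ⟨i, rfl⟩ : ∃ k, j = -k := ⟨-j, (neg_neg _).symm⟩
      exact hinv (.side i, 2) (_, _) rfl (bottom i)

/-- The faces of the dodecahedron, reached from the top face. -/
def dodecahedronWord {G : Type*} [Group G] (r t : G) : DodecahedronFace → G
  | .top => 1
  | .upper i => t * r ^ (i : ℕ)
  | .lower i => r ^ 2 * t * r ^ 3 * t * r ^ (i : ℕ)
  | .bottom => t * r ^ 2 * t * r ^ 3 * t

theorem dodecahedron_isDetermined : OrientedMap.IsDetermined.{u} dodecahedron 5 := by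
  refine OrientedMap.isDetermined_of_words fun G _ r t ht hr h3 => ?_
  have e1 := mul_inv_mul_of_pow_three ht h3
  have e2 := mul_mul_of_pow_three ht h3
  have htt : ∀ x, t * (t * x) = x := fun x => by rw [← mul_assoc, ht, one_mul]
  have hr4 : r ^ 4 = r⁻¹ := eq_inv_of_mul_eq_one_left (by rw [← pow_succ, hr])
  have hr3 : r ^ 3 = r⁻¹ * r⁻¹ := by
    rw [← mul_inv_rev]; exact eq_inv_of_mul_eq_one_left (by rw [← pow_two, ← pow_add, hr])
  -- The exponent 7 is 2 modulo 5, written as 4 + 3 to use the two inverses above.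
  have hr2 : r ^ 2 = r⁻¹ * (r⁻¹ * r⁻¹) := by
    rw [← hr3, ← hr4, ← pow_add]; exact (pow_eq_pow_mod 7 hr).symm
  refine ⟨fun d => r ^ (d.2 : ℕ) * dodecahedronWord r t d.1, ?_, ?_⟩
  · rintro ⟨F, j⟩
    change r ^ ((j + 1 : Fin 5) : ℕ) * dodecahedronWord r t F = _
    rw [pow_fin_add_one hr, mul_assoc]
  · have hinv : ∀ d e, dodecahedronOpp d = e →
        r ^ (e.2 : ℕ) * dodecahedronWord r t e.1 =
          t * (r ^ (d.2 : ℕ) * dodecahedronWord r t d.1) →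
        r ^ ((dodecahedronOpp e).2 : ℕ) * dodecahedronWord r t (dodecahedronOpp e).1 =
          t * (r ^ (e.2 : ℕ) * dodecahedronWord r t e.1) := by
      rintro d _ rfl hd
      rw [hd, htt, dodecahedronOpp_involutive]
    have top : ∀ i, r ^ ((0 : Fin 5) : ℕ) * dodecahedronWord r t (.upper i) =
        t * (r ^ (i : ℕ) * dodecahedronWord r t .top) := fun i => by simp [dodecahedronWord]
    have upper : ∀ i, r ^ ((1 : Fin 5) : ℕ) * dodecahedronWord r t (.upper (i + 1)) =
        t * (r ^ ((4 : Fin 5) : ℕ) * dodecahedronWord r t (.upper i)) := fun i => by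
      change r ^ 1 * (t * r ^ ((i + 1 : Fin 5) : ℕ)) = t * (r ^ 4 * (t * r ^ (i : ℕ)))
      rw [pow_fin_add_one hr, hr4, pow_one]
      simp only [← mul_assoc]
      rw [e1]
    have southeast : ∀ i, r ^ ((3 : Fin 5) : ℕ) * dodecahedronWord r t (.lower i) =
        t * (r ^ ((3 : Fin 5) : ℕ) * dodecahedronWord r t (.upper i)) := fun i => by
      change r ^ 3 * (r ^ 2 * t * r ^ 3 * t * r ^ (i : ℕ)) = t * (r ^ 3 * (t * r ^ (i : ℕ)))
      simp only [← mul_assoc]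
      rw [← pow_add, hr, one_mul]
    have northeast : ∀ i, r ^ ((2 : Fin 5) : ℕ) * dodecahedronWord r t (.upper (i + 1)) =
        t * (r ^ ((2 : Fin 5) : ℕ) * dodecahedronWord r t (.lower i)) := fun i => by
      change r ^ 2 * (t * r ^ ((i + 1 : Fin 5) : ℕ)) =
        t * (r ^ 2 * (r ^ 2 * t * r ^ 3 * t * r ^ (i : ℕ)))
      rw [pow_fin_add_one hr]
      calc r ^ 2 * (t * (r * r ^ (i : ℕ))) = r * (r * t * r) * r ^ (i : ℕ) := by
            simp only [pow_two, mul_assoc]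
        _ = r * (t * r⁻¹ * t) * r ^ (i : ℕ) := by rw [e1]
        _ = r * t * r * (r⁻¹ * r⁻¹) * t * r ^ (i : ℕ) := by
            simp only [mul_assoc, mul_inv_cancel_left]
        _ = t * (r⁻¹ * t * r ^ 3 * t * r ^ (i : ℕ)) := by
            rw [e1, hr3]; simp only [mul_assoc]
        _ = _ := by rw [← hr4]; simp only [mul_assoc, ← pow_add, ← mul_assoc (r ^ 2) (r ^ 2)]
    have lower : ∀ i, r ^ ((4 : Fin 5) : ℕ) * dodecahedronWord r t (.lower (i + 1)) =
        t * (r ^ ((1 : Fin 5) : ℕ) * dodecahedronWord r t (.lower i)) := fun i => by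
      change r ^ 4 * (r ^ 2 * t * r ^ 3 * t * r ^ ((i + 1 : Fin 5) : ℕ)) =
        t * (r ^ 1 * (r ^ 2 * t * r ^ 3 * t * r ^ (i : ℕ)))
      rw [pow_fin_add_one hr]
      calc r ^ 4 * (r ^ 2 * t * r ^ 3 * t * (r * r ^ (i : ℕ)))
          = r ^ 5 * ((r * t * r) * r * (r * t * r)) * r ^ (i : ℕ) := by
            simp only [pow_succ, pow_zero, one_mul, mul_assoc]
        _ = t * r⁻¹ * (t * r * t) * r⁻¹ * t * r ^ (i : ℕ) := by
            rw [e1, hr, one_mul]; simp only [mul_assoc]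
        _ = t * (r⁻¹ * r⁻¹) * t * (r⁻¹ * r⁻¹) * t * r ^ (i : ℕ) := by
            rw [e2]; simp only [mul_assoc]
        _ = t * (r * r ^ 2) * t * r ^ 3 * t * r ^ (i : ℕ) := by rw [← hr3, ← pow_succ']
        _ = _ := by simp only [pow_one, mul_assoc]
    have bottom : ∀ i, r ^ ((-i : Fin 5) : ℕ) * dodecahedronWord r t .bottom =
        t * (r ^ ((0 : Fin 5) : ℕ) * dodecahedronWord r t (.lower i)) := fun i => by
      change r ^ ((-i : Fin 5) : ℕ) * (t * r ^ 2 * t * r ^ 3 * t) =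
        t * (r ^ 0 * (r ^ 2 * t * r ^ 3 * t * r ^ (i : ℕ)))
      rw [pow_neg_mul_of_conj hr]
      · simp only [mul_assoc, pow_zero, one_mul]
      · calc r * (t * r ^ 2 * t * r ^ 3 * t) * r
            = (r * t * r) * (r * t * r) * r * (r * t * r) := by
              simp only [pow_succ, pow_zero, one_mul, mul_assoc]
          _ = t * r⁻¹ * r⁻¹ * (t * r * t) * r⁻¹ * t := by
              rw [e1]; simp only [mul_assoc, htt]
          _ = t * (r⁻¹ * (r⁻¹ * r⁻¹)) * t * (r⁻¹ * r⁻¹) * t := by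
              rw [e2]; simp only [mul_assoc]
          _ = _ := by rw [← hr2, ← hr3]
    rintro ⟨F | i | i | F, j⟩
    · exact top j
    · fin_cases j
      · exact hinv (.top, i) _ rfl (top i)
      · obtain ⟨i, rfl⟩ : ∃ k, i = k + 1 := ⟨i - 1, (sub_add_cancel _ _).symm⟩
        exact hinv (.upper i, 4) (_, _) rfl (upper i)
      · obtain ⟨i, rfl⟩ : ∃ k, i = k + 1 := ⟨i - 1, (sub_add_cancel _ _).symm⟩
        exact hinv (.lower i, 2) (_, _) rfl (northeast i)
      · exact southeast i
      · exact upper i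
    · fin_cases j
      · exact bottom i
      · exact lower i
      · exact northeast i
      · exact hinv (.upper i, 3) _ rfl (southeast i)
      · obtain ⟨i, rfl⟩ : ∃ k, i = k + 1 := ⟨i - 1, (sub_add_cancel _ _).symm⟩
        exact hinv (.lower i, 1) (_, _) rfl (lower i)
    · obtain ⟨i, rfl⟩ : ∃ k, j = -k := ⟨-j, (neg_neg _).symm⟩
      exact hinv (.lower i, 0) (_, _) rfl (bottom i)

/-! ### The two solids satisfy the hypotheses -/

theorem cube_connected : cube.Connected := by
  refine cube.connected_iff.2 fun Q h1 h2 => ?_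
  have hn : ∀ F (j : Fin 4), Q (F, j) ↔ Q (F, 0) := by
    intro F j
    have hs : ∀ j : Fin 4, Q (F, j + 1) ↔ Q (F, j) := fun j => h1 (F, j)
    fin_cases j
    · rfl
    · exact hs 0
    · exact (hs 1).trans (hs 0)
    · exact (hs 3).symm
  have hside : ∀ i, Q (.side i, 0) ↔ Q (.top, 0) := fun i => (h2 (.top, i)).trans (hn _ i)
  have hall : ∀ x, Q x ↔ Q (.top, 0) := by
    rintro ⟨F | i | F, j⟩
    · exact hn _ _
    · exact (hn _ j).trans (hside i)
    · exact (hn _ j).trans ((h2 (.side 0, 2)).trans ((hn _ 2).trans (hside 0)))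
  exact fun x y hx => (hall y).2 ((hall x).1 hx)

theorem dodecahedron_connected : dodecahedron.Connected := by
  refine dodecahedron.connected_iff.2 fun Q h1 h2 => ?_
  have hn : ∀ F (j : Fin 5), Q (F, j) ↔ Q (F, 0) := by
    intro F j
    have hs : ∀ j : Fin 5, Q (F, j + 1) ↔ Q (F, j) := fun j => h1 (F, j)
    fin_cases j
    · rfl
    · exact hs 0
    · exact (hs 1).trans (hs 0)
    · exact (hs 3).symm.trans (hs 4).symm
    · exact (hs 4).symm
  have hupper : ∀ i, Q (.upper i, 0) ↔ Q (.top, 0) := fun i => (h2 (.top, i)).trans (hn _ i)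
  have hlower : ∀ i, Q (.lower i, 0) ↔ Q (.top, 0) := fun i =>
    (hn _ 3).symm.trans ((h2 (.upper i, 3)).trans ((hn _ 3).trans (hupper i)))
  have hall : ∀ x, Q x ↔ Q (.top, 0) := by
    rintro ⟨F | i | i | F, j⟩
    · exact hn _ _
    · exact (hn _ j).trans (hupper i)
    · exact (hn _ j).trans (hlower i)
    · exact (hn _ j).trans ((h2 (.lower 0, 0)).trans (hlower 0))
  exact fun x y hx => (hall y).2 ((hall x).1 hx)

theorem cube_isTrivalent : cube.IsTrivalent 4 where
  connected := cube_connected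
  next_ne := by decide
  rot_ne := by decide
  rot_three := by decide
  minimalPeriod_next d := by
    -- Four is not prime: the period is 2 ^ (k + 1) because `next` has order dividing 4 at each dart
    -- but not 2.
    refine Function.minimalPeriod_eq_prime_pow (p := 2) (k := 1) ?_ ?_
    · revert d
      change ∀ d, ¬ cube.next (cube.next d) = d
      decide
    · revert d
      change ∀ d, cube.next (cube.next (cube.next (cube.next d))) = d
      decide

theorem dodecahedron_isTrivalent : dodecahedron.IsTrivalent 5 where
  connected := dodecahedron_connected
  next_ne := by decide
  rot_ne := by decide
  rot_three := by decide
  minimalPeriod_next d := by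
    refine minimalPeriod_eq_of_prime _ Nat.prime_five ?_ ?_
    · revert d
      decide
    · revert d
      decide

theorem cube_card : Nat.card (CubeFace × Fin 4) = 24 := by
  rw [Nat.card_eq_fintype_card]; rfl

theorem dodecahedron_card : Nat.card (DodecahedronFace × Fin 5) = 60 := by
  rw [Nat.card_eq_fintype_card]; rfl

theorem isTilingFor_avc3B24_iff {D : Type*} [Fintype D] {T : LabelledMap D Label3} :
    T.IsTilingFor avc3B24 ↔ T.IsLocalTiling 4 24 :=
  LabelledMap.isTilingFor_avcOf_iff (n := 4) (N := 24) (k := 8) (m := 6) (by norm_num) rfl rfl rfl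

theorem isTilingFor_avc3B60_iff {D : Type*} [Fintype D] {T : LabelledMap D Label3} :
    T.IsTilingFor avc3B60 ↔ T.IsLocalTiling 5 60 :=
  LabelledMap.isTilingFor_avcOf_iff (n := 5) (N := 60) (k := 20) (m := 12) (by norm_num) rfl rfl rfl

end PentTiling

theorem theorem5 :
    -- the reductions of PP₆ and PP₁₂ are tilings for the two AVCs
    ((∀ r ∈ ({PentTiling.red3B1, PentTiling.red3B2, PentTiling.red3B3} :
          Set (PentTiling.Label5 → PentTiling.Label3)),
        (PentTiling.reduction PentTiling.cube r).IsTilingFor PentTiling.avc3B24 ∧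
        (PentTiling.reduction PentTiling.dodecahedron r).IsTilingFor PentTiling.avc3B60)) ∧
    -- all tilings for AVC(3B24)
    (∀ (D : Type*) [Fintype D] (T : PentTiling.LabelledMap D PentTiling.Label3),
      (∀ r ∈ ({PentTiling.red3B1, PentTiling.red3B3} :
            Set (PentTiling.Label5 → PentTiling.Label3)),
        (T.IsTilingFor PentTiling.avc3B24 ∧ T.AdjacentInTile .β .γ) ↔
          ∃ S : Set PentTiling.cube.Face,
            T.Same (PentTiling.reorient PentTiling.cube r S)) ∧
      ((T.IsTilingFor PentTiling.avc3B24 ∧ ¬ T.AdjacentInTile .β .γ) ↔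
        ∃ c : ∀ v : PentTiling.cube.Vertex, PentTiling.Configuration PentTiling.cube v,
          T.Same (PentTiling.configure PentTiling.cube PentTiling.red3B2 c))) ∧
    -- all tilings for AVC(3B60)
    (∀ (D : Type*) [Fintype D] (T : PentTiling.LabelledMap D PentTiling.Label3),
      (∀ r ∈ ({PentTiling.red3B1, PentTiling.red3B3} :
            Set (PentTiling.Label5 → PentTiling.Label3)),
        (T.IsTilingFor PentTiling.avc3B60 ∧ T.AdjacentInTile .β .γ) ↔
          ∃ S : Set PentTiling.dodecahedron.Face,
            T.Same (PentTiling.reorient PentTiling.dodecahedron r S)) ∧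
      ((T.IsTilingFor PentTiling.avc3B60 ∧ ¬ T.AdjacentInTile .β .γ) ↔
        ∃ c : ∀ v : PentTiling.dodecahedron.Vertex,
            PentTiling.Configuration PentTiling.dodecahedron v,
          T.Same (PentTiling.configure PentTiling.dodecahedron PentTiling.red3B2 c))) := by
  have hc := PentTiling.cube_isTrivalent
  have hd := PentTiling.dodecahedron_isTrivalent
  have hc' := PentTiling.cube_card
  have hd' := PentTiling.dodecahedron_card
  refine ⟨fun r hr => ⟨PentTiling.isTilingFor_avc3B24_iff.2 (hc.isLocalTiling_reduction hc' r hr),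
    PentTiling.isTilingFor_avc3B60_iff.2 (hd.isLocalTiling_reduction hd' r hr)⟩, ?_, ?_⟩
  · intro D _ T
    rw [PentTiling.isTilingFor_avc3B24_iff]
    exact hc.classification PentTiling.cube_isDetermined hc' D T
  · intro D _ T
    rw [PentTiling.isTilingFor_avc3B60_iff]
    exact hd.classification PentTiling.dodecahedron_isDetermined hd' D T
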